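/- Fix a constant $\kappa_0$. There are constants $c_0,c_1,c_2,C>0$, depending only on $\kappa_0$, for which the following holds. Let $d,r\ge 1$, let $\boldsymbol U^\star=[\boldsymbol u_1^\star,\dots,\boldsymbol u_r^\star]\in\mathbb R^{d\times r}$ have nonzero columns, and let $\boldsymbol T^\star=\sum_{i=1}^r \boldsymbol u_i^\star\otimes\boldsymbol u_i^\star\otimes\boldsymbol u_i^\star$. Set $\lambda_{\min}^\star=\min_i\|\boldsymbol u_i^\star\|_2^3$, $\lambda_{\max}^\star=\max_i\|\boldsymbol u_i^\star\|_2^3$, $\kappa=\max_i\|\boldsymbol u_i^\star\|_2/\min_i\|\boldsymbol u_i^\star\|_2$, and $$\mu=\max\Big\{\frac{d^3\|\boldsymbol T^\star\|_\infty^2}{\|\boldsymbol T^\star\|_{\mathrm F}^2},\ \max_i\frac{d\,\|\boldsymbol u_i^\star\|_\infty^2}{\|\boldsymbol u_i^\star\|_2^2},\ \max_{i\ne j}\frac{d\,\langle\boldsymbol u_i^\star,\boldsymbol u_j^\star\rangle^2}{\|\boldsymbol u_i^\star\|_2^2\|\boldsymbol u_j^\star\|_2^2}\Big\}.$$ Let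 $\Omega\subseteq\{1,\dots,d\}^3$ be a random symmetric index set (invariant under permutations of the three indices) that contains each $(j,k,l)$ with $j\le k\le l$ independently with probability $p\in(0,1]$. For $\boldsymbol U=[\boldsymbol u_1,\dots,\boldsymbol u_r]\in\mathbb R^{d\times r}$ define the noiseless loss $$f_{\mathsf{clean}}(\boldsymbol U)=\frac1{6p}\Big\|\mathcal P_\Omega\Big(\sum_{i=1}^r\boldsymbol u_i\otimes\boldsymbol u_i\otimes\boldsymbol u_i-\boldsymbol T^\star\Big)\Big\|_{\mathrm F}^2,$$ where $\mathcal P_\Omega$ sets all entries outside $\Omega$ to zero. Suppose that $\kappa\le\kappa_0$, $$p\ge c_0\max\Big\{\frac{\log^3 d}{d^{3/2}},\frac{\mu^2r^2\log d}{d^2}\Big\},\qquad r\le c_1\sqrt{\frac d\mu},\qquad \delta\le\frac{c_2}{\mu^{3/2}r}.$$ Then, with probability at least $1-Cd^{-10}$, $$\tfrac12\,\lambda_{\min}^{\star\,4/3}\|\boldsymbol V\|_{\mathrm F}^2\ \le\ \mathrm{vec}(\boldsymbol V)^\top\nabla^2f_{\mathsf{clean}}(\boldsymbol U)\,\mathrm{vec}(\boldsymbol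 V)\ \le\ 4\,\lambda_{\max}^{\star\,4/3}\|\boldsymbol V\|_{\mathrm F}^2$$ holds simultaneously for all $\boldsymbol V\in\mathbb R^{d\times r}$ and all $\boldsymbol U\in\mathbb R^{d\times r}$ with $\|\boldsymbol U-\boldsymbol U^\star\|_{\mathrm F}\le\delta\|\boldsymbol U^\star\|_{\mathrm F}$ and $\|\boldsymbol U-\boldsymbol U^\star\|_{2,\infty}\le\delta\|\boldsymbol U^\star\|_{2,\infty}$, where $\|\cdot\|_{2,\infty}$ is the largest Euclidean norm of a row. -/

import Mathlib

open MeasureTheory ProbabilityTheory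
open scoped Matrix.Norms.Frobenius

-- In everything that follows `‖M‖` is the Frobenius norm when `M` is a matrix.

noncomputable section

/-- Real `d × d × d` arrays. The norm `‖T‖` that this type carries is the largest absolute value
of an entry. -/
abbrev Tensor3 (d : ℕ) : Type := Fin d → Fin d → Fin d → ℝ

namespace Tensor3

variable {d : ℕ}

/-- The rank-one tensor `a ⊗ b ⊗ c`, with entries `a j * b k * c l`. -/
def outer (a b c : Fin d → ℝ) : Tensor3 d := fun j k l => a j * b k * c l

/-- The squared Frobenius norm. -/
def frobSq (T : Tensor3 d) : ℝ := ∑ j, ∑ k, ∑ l, T j k l ^ 2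

/-- The projection onto the tensors that vanish outside of the index set `S`. -/
def proj (S : Set (Fin d × Fin d × Fin d)) (T : Tensor3 d) : Tensor3 d :=
  fun j k l => S.indicator (fun t => T t.1 t.2.1 t.2.2) (j, k, l)

end Tensor3

/-- The Euclidean norm of a vector. -/
def euclNorm {n : ℕ} (x : Fin n → ℝ) : ℝ := √(∑ i, x i ^ 2)

section Factors

variable {d r : ℕ}

/-- The `ℓ_{2,∞}` norm of a matrix: the largest Euclidean norm of a row. -/
def twoInftyNorm (M : Matrix (Fin d) (Fin r) ℝ) : ℝ := ⨆ i, euclNorm (M.row i)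

/-- The symmetric tensor `∑ i, uᵢ ⊗ uᵢ ⊗ uᵢ` where `u₁, …, u_r` are the columns of `U`. -/
def cpTensor (U : Matrix (Fin d) (Fin r) ℝ) : Tensor3 d :=
  ∑ i, Tensor3.outer (U.col i) (U.col i) (U.col i)

/-- `λ_min`, the smallest value of `‖uᵢ‖₂³`. -/
def lambdaMin (U : Matrix (Fin d) (Fin r) ℝ) : ℝ := ⨅ i, euclNorm (U.col i) ^ 3

/-- `λ_max`, the largest value of `‖uᵢ‖₂³`. -/
def lambdaMax (U : Matrix (Fin d) (Fin r) ℝ) : ℝ := ⨆ i, euclNorm (U.col i) ^ 3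

/-- The condition number `κ = max ‖uᵢ‖₂ / min ‖uᵢ‖₂`. -/
def condNumber (U : Matrix (Fin d) (Fin r) ℝ) : ℝ :=
  (⨆ i, euclNorm (U.col i)) / (⨅ i, euclNorm (U.col i))

/-- `μ₀ = d³ ‖T‖_∞² / ‖T‖_F²` for the tensor `T = ∑ i, uᵢ ⊗ uᵢ ⊗ uᵢ`. -/
def incoherence₀ (U : Matrix (Fin d) (Fin r) ℝ) : ℝ :=
  (d : ℝ) ^ 3 * ‖cpTensor U‖ ^ 2 / (cpTensor U).frobSq

/-- `μ₁`, the largest value of `d ‖uᵢ‖_∞² / ‖uᵢ‖₂²`; here `‖U.col i‖` is the norm of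
`Fin d → ℝ`, that is, the largest absolute value of an entry. -/
def incoherence₁ (U : Matrix (Fin d) (Fin r) ℝ) : ℝ :=
  ⨆ i, (d : ℝ) * ‖U.col i‖ ^ 2 / euclNorm (U.col i) ^ 2

/-- `μ₂`, the largest value of `d ⟨uᵢ, uⱼ⟩² / (‖uᵢ‖₂² ‖uⱼ‖₂²)` over all `i ≠ j`
(and `0` if there is no such pair). -/
def incoherence₂ (U : Matrix (Fin d) (Fin r) ℝ) : ℝ :=
  ⨆ i, ⨆ j, if i = j then 0 else
    (d : ℝ) * (U.col i ⬝ᵥ U.col j) ^ 2 / (euclNorm (U.col i) ^ 2 * euclNorm (U.col j) ^ 2)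

/-- The incoherence parameter `μ = max {μ₀, μ₁, μ₂}`. -/
def incoherence (U : Matrix (Fin d) (Fin r) ℝ) : ℝ :=
  max (incoherence₀ U) (max (incoherence₁ U) (incoherence₂ U))

/-- The loss function of the noiseless problem,
`f_clean(U) = (6p)⁻¹ ‖P_S(∑ i, uᵢ ⊗ uᵢ ⊗ uᵢ - T⋆)‖_F²` with `T⋆ = ∑ i, uᵢ⋆ ⊗ uᵢ⋆ ⊗ uᵢ⋆`. -/
def fClean (p : ℝ) (S : Set (Fin d × Fin d × Fin d)) (Ustar : Matrix (Fin d) (Fin r) ℝ)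
    (U : Matrix (Fin d) (Fin r) ℝ) : ℝ :=
  1 / (6 * p) * (Tensor3.proj S (cpTensor U - cpTensor Ustar)).frobSq

/-- The quadratic form `vec(V)ᵀ ∇²f(U) vec(V)` of the Hessian of `f` at `U`: the second Fréchet
derivative of `f` at `U`, evaluated at `(V, V)`. -/
def hessianForm (f : Matrix (Fin d) (Fin r) ℝ → ℝ) (U V : Matrix (Fin d) (Fin r) ℝ) : ℝ :=
  iteratedFDeriv ℝ 2 f U ![V, V]

end Factors

/-- `S` is a random symmetric subset of `{1, …, d}³` in which every index `(j, k, l)` with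
`j ≤ k ≤ l` is included independently with probability `p`. -/
structure IsSymmetricSampling {Ω : Type*} [MeasurableSpace Ω] (P : Measure Ω) {d : ℕ} (p : ℝ)
    (S : Ω → Set (Fin d × Fin d × Fin d)) : Prop where
  /-- Membership does not change when two neighbouring indices are swapped, hence under no
  permutation of the three indices. -/
  symm : ∀ ω j k l, (j, k, l) ∈ S ω → (k, j, l) ∈ S ω ∧ (j, l, k) ∈ S ω
  measurableSet : ∀ t, MeasurableSet {ω | t ∈ S ω}
  indep : iIndepSet
    (fun t : {t : Fin d × Fin d × Fin d // t.1 ≤ t.2.1 ∧ t.2.1 ≤ t.2.2} => {ω | t.1 ∈ S ω}) P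
  prob : ∀ t : Fin d × Fin d × Fin d, t.1 ≤ t.2.1 → t.2.1 ≤ t.2.2 → P.real {ω | t ∈ S ω} = p

end

/-!
Write `u` for the columns of `U⋆`, `D = ∑ i, (vᵢ ⊗ uᵢ ⊗ uᵢ + uᵢ ⊗ vᵢ ⊗ uᵢ + uᵢ ⊗ uᵢ ⊗ vᵢ)` for the
derivative of `U ↦ ∑ i, uᵢ ⊗ uᵢ ⊗ uᵢ` in the direction `V`, and `E` for half of the second
derivative. Along a line the loss is a polynomial, so that (`hessianForm_fClean`)
`vec(V)ᵀ ∇²f(U) vec(V) = (3p)⁻¹ ‖P_S D‖² + (2/3) p⁻¹ ⟨P_S (T(U) - T⋆), E⟩`.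

* At `U = U⋆` and without sampling, the first term is `‖D‖² / 3`. Nearly orthogonal columns make it
  lie between `σ_min⁴ ‖V‖²` and `3 σ_max⁴ ‖V‖²`, up to a multiple of `r √(μ / d)`
  (`sum_tangentEntry_sq_bounds`).
* `‖P_S D‖²` is a quadratic form in `V`, a sum of rank-one forms `⟨a x, V⟩²` over the sampled
  triples `x`, and incoherence bounds `‖a x‖² ≤ 9 r μ² σ_max⁴ / d²`. A matrix Chernoff bound in
  dimension `d r` therefore replaces `p⁻¹ ‖P_S D‖²` by `‖D‖²` as soon as `p` exceeds a multiple of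
  `r μ² log d / d²` (`IsSymmetricSampling.measureReal_tangent`).
* Moving from `U⋆` to `U`, and the term with `E`, are handled for all `U` and `V` at once, by
  Cauchy-Schwarz over the sampled entries. Of the sample this only needs bounds for the number of
  triples with a given first index, weighted by the entries of a column
  (`IsSymmetricSampling.measureReal_degree`).

The Chernoff bound rests on the fact that, for Bernoulli `ξ` and a suitable `c`, adding
`(θ ξ - c) a aᵀ` to a symmetric matrix does not increase the expectation of `tr exp`
(`isCompensator_upper`, `isCompensator_lower`). For rank-one steps this needs neither the
Golden-Thompson inequality nor Lieb's theorem: it follows from the convexity of `tr exp`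
(`trace_exp_add_rankOne_ge`) together with `⟨a, exp (D + x a aᵀ) a⟩ ≤ exp (x ‖a‖²) ⟨a, exp D a⟩`
(`dotProduct_exp_add_rankOne_le`), which holds term by term in the exponential series after a
positive shift of `D`.
-/

/-! ### The exponential of a symmetric matrix under rank-one perturbations -/

section MatrixExp

open Matrix

lemma hasSum_pow_mul_div_factorial (y w : ℝ) :
    HasSum (fun k : ℕ => y ^ k * w / k.factorial) (Real.exp y * w) := by
  have := (NormedSpace.expSeries_div_hasSum_exp y).mul_right w
  rw [← Real.exp_eq_exp_ℝ] at this
  simpa only [mul_div_right_comm] using this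

lemma isHermitian_smul_vecMulVec {n : Type*} (x : ℝ) (a : n → ℝ) :
    (x • vecMulVec a a).IsHermitian := by
  ext i j
  simp [vecMulVec_apply, mul_comm]

lemma dotProduct_vecMulVec_mulVec {n : Type*} [Fintype n] (a v w : n → ℝ) :
    v ⬝ᵥ vecMulVec a a *ᵥ w = (v ⬝ᵥ a) * (a ⬝ᵥ w) := by
  rw [vecMulVec_mulVec, op_smul_eq_smul, dotProduct_smul, smul_eq_mul, mul_comm]

variable {n : Type*} [Fintype n] [DecidableEq n]

/-- `Q * diag f * Qᵀ`; for orthogonal `Q` this is the function `f` of a symmetric matrix with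
eigenvectors the columns of `Q`. -/
noncomputable def conjDiag (Q : Matrix n n ℝ) (f : n → ℝ) : Matrix n n ℝ :=
  Q * diagonal f * Qᵀ

lemma exists_eq_conjDiag (H : Matrix n n ℝ) (hH : H.IsHermitian) :
    ∃ (Q : Matrix n n ℝ) (f : n → ℝ), Qᵀ * Q = 1 ∧ Q * Qᵀ = 1 ∧ H = conjDiag Q f := by
  refine ⟨hH.eigenvectorUnitary, hH.eigenvalues, ?_, ?_, ?_⟩
  · have := Unitary.coe_star_mul_self hH.eigenvectorUnitary
    simpa [star_eq_conjTranspose, conjTranspose_eq_transpose_of_trivial] using this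
  · have := Unitary.coe_mul_star_self hH.eigenvectorUnitary
    simpa [star_eq_conjTranspose, conjTranspose_eq_transpose_of_trivial] using this
  · have := hH.spectral_theorem
    rw [Unitary.conjStarAlgAut_apply] at this
    simpa [star_eq_conjTranspose, conjTranspose_eq_transpose_of_trivial, conjDiag] using this

lemma conjDiag_mul {Q : Matrix n n ℝ} (hQ : Qᵀ * Q = 1) (f g : n → ℝ) :
    conjDiag Q f * conjDiag Q g = conjDiag Q (f * g) := by
  have : conjDiag Q f * conjDiag Q g = Q * diagonal f * (Qᵀ * Q) * diagonal g * Qᵀ := by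
    simp only [conjDiag, Matrix.mul_assoc]
  rw [this, hQ, Matrix.mul_one, Matrix.mul_assoc Q, diagonal_mul_diagonal]
  rfl

lemma conjDiag_one {Q : Matrix n n ℝ} (hQ : Q * Qᵀ = 1) : conjDiag Q 1 = 1 := by
  simp only [conjDiag, Pi.one_def, diagonal_one, Matrix.mul_one, hQ]

lemma conjDiag_add (Q : Matrix n n ℝ) (f g : n → ℝ) :
    conjDiag Q (f + g) = conjDiag Q f + conjDiag Q g := by
  simp only [conjDiag, ← Matrix.add_mul, ← Matrix.mul_add, diagonal_add, Pi.add_def]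

lemma conjDiag_smul (Q : Matrix n n ℝ) (x : ℝ) (f : n → ℝ) :
    conjDiag Q (x • f) = x • conjDiag Q f := by
  simp only [conjDiag, diagonal_smul, Matrix.mul_smul, Matrix.smul_mul]

lemma conjDiag_pow {Q : Matrix n n ℝ} (hQ : Qᵀ * Q = 1) (hQ' : Q * Qᵀ = 1) (f : n → ℝ) (k : ℕ) :
    conjDiag Q f ^ k = conjDiag Q (f ^ k) := by
  induction k with
  | zero => rw [pow_zero, pow_zero, conjDiag_one hQ']
  | succ k ih => rw [pow_succ, ih, conjDiag_mul hQ, pow_succ]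

lemma exp_conjDiag {Q : Matrix n n ℝ} (hQ : Qᵀ * Q = 1) (f : n → ℝ) :
    NormedSpace.exp (conjDiag Q f) = conjDiag Q (fun i => Real.exp (f i)) := by
  have hinv : Q⁻¹ = Qᵀ := inv_eq_left_inv hQ
  have hu : IsUnit Q := IsUnit.of_mul_eq_one_right _ hQ
  have h := Matrix.exp_conj Q (diagonal f) hu
  rw [hinv, Matrix.exp_diagonal] at h
  rw [conjDiag, h, conjDiag]
  congr 3
  ext i
  rw [Pi.coe_exp, Real.exp_eq_exp_ℝ]

lemma dotProduct_conjDiag_mulVec (Q : Matrix n n ℝ) (f : n → ℝ) (a : n → ℝ) :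
    a ⬝ᵥ conjDiag Q f *ᵥ a = ∑ i, f i * (a ᵥ* Q) i ^ 2 := by
  rw [conjDiag, ← mulVec_mulVec, ← mulVec_mulVec, dotProduct_mulVec, mulVec_transpose]
  simp only [dotProduct, mulVec_diagonal]
  exact Finset.sum_congr rfl fun i _ => by ring

lemma trace_conjDiag {Q : Matrix n n ℝ} (hQ : Qᵀ * Q = 1) (f : n → ℝ) :
    (conjDiag Q f).trace = ∑ i, f i := by
  rw [conjDiag, trace_mul_comm, ← Matrix.mul_assoc, hQ, Matrix.one_mul, trace_diagonal]

lemma sum_vecMul_sq {Q : Matrix n n ℝ} (hQ : Q * Qᵀ = 1) (a : n → ℝ) :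
    ∑ i, (a ᵥ* Q) i ^ 2 = a ⬝ᵥ a := by
  have h := dotProduct_conjDiag_mulVec Q 1 a
  rw [conjDiag_one hQ, one_mulVec] at h
  simp [h]

/-- The scalar tangent inequality `exp y ≥ exp m * (1 + y - m)`, integrated against the spectral
measure of a symmetric matrix at a vector. -/
lemma exp_mul_le_dotProduct_exp_mulVec {G : Matrix n n ℝ} (hG : G.IsHermitian) (v : n → ℝ)
    (m : ℝ) :
    Real.exp m * ((1 - m) * (v ⬝ᵥ v) + v ⬝ᵥ G *ᵥ v) ≤ v ⬝ᵥ NormedSpace.exp G *ᵥ v := by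
  obtain ⟨Q, f, hQ, hQ', rfl⟩ := exists_eq_conjDiag G hG
  rw [exp_conjDiag hQ, dotProduct_conjDiag_mulVec, dotProduct_conjDiag_mulVec,
    ← sum_vecMul_sq hQ' v, Finset.mul_sum, ← Finset.sum_add_distrib, Finset.mul_sum]
  refine Finset.sum_le_sum fun i _ => ?_
  have h1 : Real.exp m * (1 - m + f i) ≤ Real.exp (f i) := by
    have := Real.add_one_le_exp (f i - m)
    rw [Real.exp_sub, le_div_iff₀ (Real.exp_pos m)] at this
    linarith
  nlinarith [sq_nonneg ((v ᵥ* Q) i)]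

lemma dotProduct_exp_mulVec_nonneg {G : Matrix n n ℝ} (hG : G.IsHermitian) (v : n → ℝ) :
    0 ≤ v ⬝ᵥ NormedSpace.exp G *ᵥ v := by
  obtain ⟨Q, f, hQ, hQ', rfl⟩ := exists_eq_conjDiag G hG
  rw [exp_conjDiag hQ, dotProduct_conjDiag_mulVec]
  exact Finset.sum_nonneg fun i _ => mul_nonneg (Real.exp_pos _).le (sq_nonneg _)

lemma trace_exp_nonneg {G : Matrix n n ℝ} (hG : G.IsHermitian) :
    0 ≤ (NormedSpace.exp G).trace := by
  obtain ⟨Q, f, hQ, hQ', rfl⟩ := exists_eq_conjDiag G hG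
  rw [exp_conjDiag hQ, trace_conjDiag hQ]
  exact Finset.sum_nonneg fun i _ => (Real.exp_pos _).le

/-- If the quadratic form of `G` exceeds `s` somewhere on the unit sphere then
`exp s ≤ tr (exp G)`. -/
lemma exp_le_trace_exp {G : Matrix n n ℝ} (hG : G.IsHermitian) {s : ℝ} {v : n → ℝ}
    (hv : s * (v ⬝ᵥ v) < v ⬝ᵥ G *ᵥ v) : Real.exp s ≤ (NormedSpace.exp G).trace := by
  obtain ⟨Q, f, hQ, hQ', rfl⟩ := exists_eq_conjDiag G hG
  rw [dotProduct_conjDiag_mulVec, ← sum_vecMul_sq hQ' v, Finset.mul_sum] at hv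
  obtain ⟨i, -, hi⟩ := Finset.exists_lt_of_sum_lt hv
  have hsf : s ≤ f i := by
    by_contra! h
    nlinarith [sq_nonneg ((v ᵥ* Q) i)]
  rw [exp_conjDiag hQ, trace_conjDiag hQ]
  exact (Real.exp_le_exp.2 hsf).trans
    (Finset.single_le_sum (f := fun i => Real.exp (f i)) (fun j _ => (Real.exp_pos _).le)
      (Finset.mem_univ i))

/-- Klein's inequality for a perturbation of rank one: `tr exp` is convex, with derivative
`⟨a, exp H a⟩` in the direction `a aᵀ`. -/
lemma trace_exp_add_rankOne_ge {H : Matrix n n ℝ} (hH : H.IsHermitian) (a : n → ℝ) (x : ℝ) :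
    (NormedSpace.exp H).trace + x * (a ⬝ᵥ NormedSpace.exp H *ᵥ a)
      ≤ (NormedSpace.exp (H + x • vecMulVec a a)).trace := by
  have hG := hH.add (isHermitian_smul_vecMulVec x a)
  obtain ⟨Q, f, hQ, hQ', hHQ⟩ := exists_eq_conjDiag H hH
  set G := H + x • vecMulVec a a with hGdef
  -- the trace of `exp G` is computed in an eigenbasis of `H`
  have htr : (NormedSpace.exp G).trace
      = ∑ i, (fun k => Q k i) ⬝ᵥ NormedSpace.exp G *ᵥ (fun k => Q k i) := by
    have h1 : (NormedSpace.exp G).trace = (Qᵀ * (NormedSpace.exp G * Q)).trace := by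
      rw [trace_mul_comm, Matrix.mul_assoc, hQ', Matrix.mul_one]
    rw [h1]
    simp only [trace, diag_apply, mul_apply, transpose_apply, dotProduct, mulVec]
  have hcol : ∀ i, (fun k => Q k i) ⬝ᵥ (fun k => Q k i) = 1 := fun i => by
    have := congrFun (congrFun hQ i) i
    simpa [mul_apply, dotProduct] using this
  have hquad : ∀ i, (fun k => Q k i) ⬝ᵥ G *ᵥ (fun k => Q k i) = f i + x * (a ᵥ* Q) i ^ 2 := by
    intro i
    have h1 : (fun k => Q k i) ⬝ᵥ H *ᵥ (fun k => Q k i) = f i := by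
      have h2 : Qᵀ * (H * Q) = diagonal f := by
        rw [hHQ, conjDiag, Matrix.mul_assoc _ Qᵀ Q, hQ, Matrix.mul_one, ← Matrix.mul_assoc, hQ,
          Matrix.one_mul]
      have := congrFun (congrFun h2 i) i
      simpa [mul_apply, dotProduct, mulVec] using this
    rw [hGdef, add_mulVec, dotProduct_add, h1, smul_mulVec, dotProduct_smul,
      dotProduct_vecMulVec_mulVec, dotProduct_comm _ a, smul_eq_mul, ← sq]
    rfl
  rw [htr, hHQ, exp_conjDiag hQ, trace_conjDiag hQ, dotProduct_conjDiag_mulVec, Finset.mul_sum,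
    ← Finset.sum_add_distrib]
  refine Finset.sum_le_sum fun i _ => ?_
  have := exp_mul_le_dotProduct_exp_mulVec hG (fun k => Q k i) (f i)
  rw [hcol, hquad] at this
  linarith

/-- Chebyshev's sum inequality for weights `w` of arbitrary total mass. -/
lemma sum_mul_sum_le_of_monovary {ι : Type*} [Fintype ι] {w f g : ι → ℝ} (hw : ∀ i, 0 ≤ w i)
    (hfg : Monovary f g) :
    (∑ i, f i * w i) * (∑ i, g i * w i) ≤ (∑ i, w i) * ∑ i, f i * g i * w i := by
  have h : 0 ≤ ∑ i, ∑ j, w i * w j * ((f i - f j) * (g i - g j)) := by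
    refine Finset.sum_nonneg fun i _ => Finset.sum_nonneg fun j _ =>
      mul_nonneg (mul_nonneg (hw i) (hw j)) ?_
    rcases lt_trichotomy (g i) (g j) with hij | hij | hij
    · exact mul_nonneg_of_nonpos_of_nonpos (sub_nonpos.2 (hfg hij)) (sub_nonpos.2 hij.le)
    · simp [hij]
    · exact mul_nonneg (sub_nonneg.2 (hfg hij)) (sub_nonneg.2 hij.le)
  have e : ∑ i, ∑ j, w i * w j * ((f i - f j) * (g i - g j))
      = 2 * ((∑ i, w i) * ∑ i, f i * g i * w i) - 2 * ((∑ i, f i * w i) * (∑ i, g i * w i)) := by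
    have e1 : ∑ i, ∑ j, w i * w j * ((f i - f j) * (g i - g j))
        = ∑ i, ∑ j, ((f i * g i * w i) * w j + w i * (f j * g j * w j)
          - (f i * w i) * (g j * w j) - (g i * w i) * (f j * w j)) :=
      Finset.sum_congr rfl fun i _ => Finset.sum_congr rfl fun j _ => by ring
    rw [e1]
    simp only [Finset.sum_sub_distrib, Finset.sum_add_distrib, ← Finset.sum_mul_sum]
    ring
  linarith

/-- For a positive semidefinite `D`, replacing a factor `D + x a aᵀ` by `D + x ‖a‖²` increases the
moments at `a`: each occurrence of `a aᵀ` splits the moment into a product of two moments, which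
Chebyshev's inequality recombines. -/
lemma moment_add_rankOne_le {Q : Matrix n n ℝ} (hQ : Qᵀ * Q = 1) (hQ' : Q * Qᵀ = 1) {f : n → ℝ}
    (hf : ∀ i, 0 ≤ f i) (a : n → ℝ) {x : ℝ} (hx : 0 ≤ x) (k m : ℕ) :
    a ⬝ᵥ (conjDiag Q f ^ m * (conjDiag Q f + x • vecMulVec a a) ^ k) *ᵥ a
      ≤ ∑ i, f i ^ m * (f i + x * (a ⬝ᵥ a)) ^ k * (a ᵥ* Q) i ^ 2 := by
  have ha : 0 ≤ a ⬝ᵥ a := by simpa using dotProduct_star_self_nonneg a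
  induction k generalizing m with
  | zero =>
    rw [pow_zero, Matrix.mul_one, conjDiag_pow hQ hQ', dotProduct_conjDiag_mulVec]
    simp
  | succ k ih =>
    set G := conjDiag Q f + x • vecMulVec a a with hG
    have hsplit : a ⬝ᵥ (conjDiag Q f ^ m * G ^ (k + 1)) *ᵥ a
        = a ⬝ᵥ (conjDiag Q f ^ (m + 1) * G ^ k) *ᵥ a
          + x * ((a ⬝ᵥ (conjDiag Q f ^ m) *ᵥ a) * (a ⬝ᵥ (conjDiag Q f ^ 0 * G ^ k) *ᵥ a)) := by
      have h1 : conjDiag Q f ^ m * G ^ (k + 1)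
          = conjDiag Q f ^ (m + 1) * G ^ k
            + x • (conjDiag Q f ^ m * (vecMulVec a a * G ^ k)) := by
        rw [pow_succ' G, hG, Matrix.add_mul, Matrix.mul_add, ← Matrix.mul_assoc, ← pow_succ,
          Matrix.smul_mul, Matrix.mul_smul]
      rw [h1, add_mulVec, dotProduct_add, smul_mulVec, dotProduct_smul, smul_eq_mul, pow_zero,
        Matrix.one_mul, ← mulVec_mulVec, ← mulVec_mulVec, ← mulVec_mulVec, vecMulVec_mulVec,
        op_smul_eq_smul, mulVec_smul, dotProduct_smul, smul_eq_mul]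
      ring
    have h0 := ih 0
    have h1 := ih (m + 1)
    rw [hsplit]
    have hmono : Monovary (fun i => f i ^ m) (fun i => (f i + x * (a ⬝ᵥ a)) ^ k) := by
      intro i j hij
      have : f i ≤ f j := by
        by_contra! h
        have := pow_le_pow_left₀ (by have := hf j; positivity)
          (by linarith : f j + x * (a ⬝ᵥ a) ≤ f i + x * (a ⬝ᵥ a)) k
        exact absurd hij (not_lt.2 this)
      exact pow_le_pow_left₀ (hf i) this m
    have hcheb := sum_mul_sum_le_of_monovary (w := fun i => (a ᵥ* Q) i ^ 2)
      (fun i => sq_nonneg _) hmono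
    rw [sum_vecMul_sq hQ'] at hcheb
    have hm : a ⬝ᵥ (conjDiag Q f ^ m) *ᵥ a = ∑ i, f i ^ m * (a ᵥ* Q) i ^ 2 := by
      rw [conjDiag_pow hQ hQ', dotProduct_conjDiag_mulVec]
      rfl
    have hm0 : 0 ≤ ∑ i, f i ^ m * (a ᵥ* Q) i ^ 2 :=
      Finset.sum_nonneg fun i _ => mul_nonneg (pow_nonneg (hf i) _) (sq_nonneg _)
    have h2 : x * ((a ⬝ᵥ (conjDiag Q f ^ m) *ᵥ a) * (a ⬝ᵥ (conjDiag Q f ^ 0 * G ^ k) *ᵥ a))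
        ≤ x * ((a ⬝ᵥ a) * ∑ i, f i ^ m * (f i + x * (a ⬝ᵥ a)) ^ k * (a ᵥ* Q) i ^ 2) := by
      refine mul_le_mul_of_nonneg_left ((?_ : _ ≤ _).trans hcheb) hx
      rw [hm]
      refine mul_le_mul_of_nonneg_left (h0.trans (le_of_eq ?_)) hm0
      simp
    refine (add_le_add h1 h2).trans (le_of_eq ?_)
    rw [Finset.mul_sum, Finset.mul_sum, ← Finset.sum_add_distrib]
    exact Finset.sum_congr rfl fun i _ => by ring

lemma hasSum_dotProduct_exp_mulVec {G : Matrix n n ℝ} (hG : G.IsHermitian) (a : n → ℝ) :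
    HasSum (fun k : ℕ => (a ⬝ᵥ (G ^ k) *ᵥ a) / k.factorial)
      (a ⬝ᵥ NormedSpace.exp G *ᵥ a) := by
  obtain ⟨Q, f, hQ, hQ', rfl⟩ := exists_eq_conjDiag G hG
  simp only [conjDiag_pow hQ hQ', exp_conjDiag hQ, dotProduct_conjDiag_mulVec, Finset.sum_div]
  refine hasSum_sum fun i _ => ?_
  exact hasSum_pow_mul_div_factorial (f i) _

/-- A perturbation by `x a aᵀ` multiplies `⟨a, exp D a⟩` by at most `exp (x ‖a‖²)`, although `D`
and `a aᵀ` need not commute. -/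
lemma dotProduct_exp_add_rankOne_le {D : Matrix n n ℝ} (hD : D.IsHermitian) (a : n → ℝ) {x : ℝ}
    (hx : 0 ≤ x) :
    a ⬝ᵥ NormedSpace.exp (D + x • vecMulVec a a) *ᵥ a
      ≤ Real.exp (x * (a ⬝ᵥ a)) * (a ⬝ᵥ NormedSpace.exp D *ᵥ a) := by
  obtain ⟨Q, f, hQ, hQ', hDQ⟩ := exists_eq_conjDiag D hD
  -- a shift by a multiple of the identity makes the matrix positive semidefinite
  obtain ⟨K, hK⟩ : ∃ K : ℝ, ∀ i, 0 ≤ K + f i :=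
    ⟨∑ i, |f i|, fun i => by
      have := Finset.single_le_sum (f := fun i => |f i|) (fun j _ => abs_nonneg _)
        (Finset.mem_univ i)
      have := neg_abs_le (f i)
      linarith⟩
  set g : n → ℝ := fun i => K + f i with hg
  have hgD : conjDiag Q g = K • (1 : Matrix n n ℝ) + D := by
    have : g = K • (1 : n → ℝ) + f := by ext i; simp [hg]
    rw [this, conjDiag_add, conjDiag_smul, conjDiag_one hQ', hDQ]
  have hshift : ∀ M : Matrix n n ℝ,
      NormedSpace.exp (K • (1 : Matrix n n ℝ) + M) = Real.exp K • NormedSpace.exp M := by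
    intro M
    have hc : Commute (K • (1 : Matrix n n ℝ)) M := (Commute.one_left M).smul_left K
    rw [Matrix.exp_add_of_commute _ _ hc]
    have : K • (1 : Matrix n n ℝ) = conjDiag 1 (fun _ => K) := by
      ext i j; simp [conjDiag, one_apply]
    rw [this, exp_conjDiag (by simp)]
    ext i j; simp [conjDiag]
  have hherm := hD.add (isHermitian_smul_vecMulVec x a)
  have hg' : conjDiag Q g + x • vecMulVec a a
      = K • (1 : Matrix n n ℝ) + (D + x • vecMulVec a a) := by rw [hgD, add_assoc]
  have hKh : (K • (1 : Matrix n n ℝ)).IsHermitian := by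
    ext i j; simp [one_apply, eq_comm]
  have hs1 := hasSum_dotProduct_exp_mulVec (hKh.add hherm) a
  rw [hshift, ← hg'] at hs1
  have hs2 : HasSum (fun k : ℕ => (∑ i, (g i + x * (a ⬝ᵥ a)) ^ k * (a ᵥ* Q) i ^ 2) / k.factorial)
      (∑ i, Real.exp (g i + x * (a ⬝ᵥ a)) * (a ᵥ* Q) i ^ 2) := by
    simp only [Finset.sum_div]
    refine hasSum_sum fun i _ => ?_
    exact hasSum_pow_mul_div_factorial _ _
  have hle := hasSum_le (fun k => ?_) hs1 hs2
  · rw [smul_mulVec, dotProduct_smul, smul_eq_mul] at hle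
    have he : ∑ i, Real.exp (g i + x * (a ⬝ᵥ a)) * (a ᵥ* Q) i ^ 2
        = Real.exp K * (Real.exp (x * (a ⬝ᵥ a)) * (a ⬝ᵥ NormedSpace.exp D *ᵥ a)) := by
      rw [hDQ, exp_conjDiag hQ, dotProduct_conjDiag_mulVec, Finset.mul_sum, Finset.mul_sum]
      refine Finset.sum_congr rfl fun i _ => ?_
      rw [hg, Real.exp_add, Real.exp_add]
      ring
    rw [he] at hle
    exact le_of_mul_le_mul_left hle (Real.exp_pos K)
  · have := moment_add_rankOne_le hQ hQ' (f := g) hK a hx k 0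
    simp only [pow_zero, one_mul] at this
    gcongr

end MatrixExp

/-! ### The matrix Chernoff bound for rank-one summands -/

section BernoulliSums

open Matrix

variable {n : Type*} [Fintype n] [DecidableEq n] {ι : Type*}

/-- `c` is a centring constant that makes `tr exp` of a walk with steps `(ξ α - c) a aᵀ`, where `ξ`
is Bernoulli with parameter `p`, a supermartingale. -/
def IsCompensator (p α c : ℝ) (a : n → ℝ) : Prop :=
  ∀ D : Matrix n n ℝ, D.IsHermitian →
    (1 - p) * (NormedSpace.exp (D + (0 - c) • vecMulVec a a)).trace
      + p * (NormedSpace.exp (D + (α - c) • vecMulVec a a)).trace ≤ (NormedSpace.exp D).trace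

/-- With `D' = D - c a aᵀ`, convexity bounds `tr exp D` from below and `tr exp (D' + θ a aᵀ)` from
above by expressions linear in `⟨a, exp D' a⟩`. -/
lemma isCompensator_upper {p θ R : ℝ} (hp : 0 ≤ p) (hθ : 0 ≤ θ) {a : n → ℝ}
    (ha : a ⬝ᵥ a ≤ R) : IsCompensator p θ (p * (θ * Real.exp (θ * R))) a := by
  intro D hD
  set c := p * (θ * Real.exp (θ * R)) with hc
  set D' := D + (0 - c) • vecMulVec a a with hD'
  have hD'h : D'.IsHermitian := hD.add (isHermitian_smul_vecMulVec _ a)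
  have hH : (D' + θ • vecMulVec a a).IsHermitian := hD'h.add (isHermitian_smul_vecMulVec _ a)
  have e1 : D + (θ - c) • vecMulVec a a = D' + θ • vecMulVec a a := by
    rw [hD', add_assoc, ← add_smul]; congr 2; ring
  have e2 : D = D' + c • vecMulVec a a := by
    rw [hD', add_assoc, ← add_smul]; simp
  have e3 : D' = (D' + θ • vecMulVec a a) + (-θ) • vecMulVec a a := by
    rw [add_assoc, ← add_smul]; simp
  have k1 := trace_exp_add_rankOne_ge hD'h a c
  rw [← e2] at k1
  have k2 := trace_exp_add_rankOne_ge hH a (-θ)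
  rw [← e3] at k2
  have k3 := dotProduct_exp_add_rankOne_le hD'h a hθ
  have k0 := dotProduct_exp_mulVec_nonneg hD'h a
  have k4 : Real.exp (θ * (a ⬝ᵥ a)) ≤ Real.exp (θ * R) :=
    Real.exp_le_exp.2 (mul_le_mul_of_nonneg_left ha hθ)
  rw [e1]
  set q := a ⬝ᵥ NormedSpace.exp D' *ᵥ a
  have k5 := k3.trans (mul_le_mul_of_nonneg_right k4 k0)
  have k6 : (NormedSpace.exp (D' + θ • vecMulVec a a)).trace
      ≤ (NormedSpace.exp D').trace + θ * (Real.exp (θ * R) * q) := by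
    linarith [mul_le_mul_of_nonneg_left k5 hθ]
  linarith [mul_le_mul_of_nonneg_left k6 hp]

/-- The compensator for the downward steps `-θ ξ a aᵀ`, by the same comparison as for the upward
steps, centred at `D' = D + c a aᵀ`. -/
lemma isCompensator_lower {p θ R : ℝ} (hp : 0 ≤ p) (hθ : 0 ≤ θ) {a : n → ℝ}
    (ha : a ⬝ᵥ a ≤ R) : IsCompensator p (-θ) (-(p * (θ * Real.exp (-(θ * R))))) a := by
  intro D hD
  set c := p * (θ * Real.exp (-(θ * R))) with hc
  set D' := D + (0 - -c) • vecMulVec a a with hD'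
  set D'' := D' + (-θ) • vecMulVec a a with hD''
  have hD'h : D'.IsHermitian := hD.add (isHermitian_smul_vecMulVec _ a)
  have hD''h : D''.IsHermitian := hD'h.add (isHermitian_smul_vecMulVec _ a)
  have e1 : D + (-θ - -c) • vecMulVec a a = D'' := by
    rw [hD'', hD', add_assoc, ← add_smul]; congr 2; ring
  have e2 : D = D' + (-c) • vecMulVec a a := by
    rw [hD', add_assoc, ← add_smul]; simp
  have e3 : D' = D'' + θ • vecMulVec a a := by
    rw [hD'', add_assoc, ← add_smul]; simp
  have k1 := trace_exp_add_rankOne_ge hD'h a (-c)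
  rw [← e2] at k1
  have k2 := trace_exp_add_rankOne_ge hD''h a θ
  rw [← e3] at k2
  have k3 := dotProduct_exp_add_rankOne_le hD''h a hθ
  rw [← e3] at k3
  have k0 := dotProduct_exp_mulVec_nonneg hD''h a
  have k4 : Real.exp (θ * (a ⬝ᵥ a)) ≤ Real.exp (θ * R) :=
    Real.exp_le_exp.2 (mul_le_mul_of_nonneg_left ha hθ)
  rw [e1]
  have k5 := k3.trans (mul_le_mul_of_nonneg_right k4 k0)
  have k6 : Real.exp (-(θ * R)) * (a ⬝ᵥ NormedSpace.exp D' *ᵥ a)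
      ≤ a ⬝ᵥ NormedSpace.exp D'' *ᵥ a := by
    rw [Real.exp_neg, inv_mul_le_iff₀ (Real.exp_pos _)]
    exact k5
  have k7 : (NormedSpace.exp D'').trace + θ * (Real.exp (-(θ * R)) *
      (a ⬝ᵥ NormedSpace.exp D' *ᵥ a)) ≤ (NormedSpace.exp D').trace := by
    linarith [mul_le_mul_of_nonneg_left k6 hθ]
  linarith [mul_le_mul_of_nonneg_left k7 hp]

/-- The expectation of `tr exp` of the compensated random sum, written as a sum over the possible
sets `B` of successes. -/
lemma sum_powerset_trace_exp_le [DecidableEq ι] {p α c : ℝ} {a : ι → n → ℝ}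
    (h : ∀ t, IsCompensator p α c (a t)) (hp : 0 ≤ p) (hp1 : p ≤ 1) (T : Finset ι)
    {D : Matrix n n ℝ} (hD : D.IsHermitian) :
    ∑ B ∈ T.powerset, (∏ t ∈ T, if t ∈ B then p else 1 - p) *
      (NormedSpace.exp
        (D + ∑ t ∈ T, ((if t ∈ B then α else 0) - c) • vecMulVec (a t) (a t))).trace
      ≤ (NormedSpace.exp D).trace := by
  induction T using Finset.induction_on generalizing D with
  | empty => simp
  | insert t₀ T ht ih =>
    rw [Finset.sum_powerset_insert ht]
    refine le_trans (le_of_eq ?_) (h t₀ D hD |>.trans' (add_le_add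
      (mul_le_mul_of_nonneg_left (ih (hD.add (isHermitian_smul_vecMulVec (0 - c) (a t₀))))
        (sub_nonneg.2 hp1))
      (mul_le_mul_of_nonneg_left (ih (hD.add (isHermitian_smul_vecMulVec (α - c) (a t₀)))) hp)))
    rw [Finset.mul_sum, Finset.mul_sum]
    congr 1
    · refine Finset.sum_congr rfl fun B hB => ?_
      have hB0 : t₀ ∉ B := fun h' => ht (Finset.mem_powerset.1 hB h')
      rw [Finset.prod_insert ht, Finset.sum_insert ht, if_neg hB0, if_neg hB0, mul_assoc, add_assoc]
    · refine Finset.sum_congr rfl fun B hB => ?_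
      have hmem : ∀ t ∈ T, (t ∈ insert t₀ B ↔ t ∈ B) := fun t htT => by
        rw [Finset.mem_insert, or_iff_right]
        rintro rfl
        exact ht htT
      rw [Finset.prod_insert ht, Finset.sum_insert ht, if_pos (Finset.mem_insert_self _ _),
        if_pos (Finset.mem_insert_self _ _), mul_assoc, add_assoc,
        Finset.prod_congr rfl fun t htT => if_congr (hmem t htT) rfl rfl,
        Finset.sum_congr rfl fun t htT => by rw [if_congr (hmem t htT) rfl rfl]]

variable {Ω : Type*} [MeasurableSpace Ω] {P : Measure Ω} [IsProbabilityMeasure P]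

open Classical in
/-- The joint law of independent events of probability `p`. -/
lemma measureReal_filter_eq [Fintype ι] {E : ι → Set Ω} {p : ℝ}
    (hE : ∀ t, MeasurableSet (E t)) (hind : iIndepSet E P) (hp : ∀ t, P.real (E t) = p)
    (B : Finset ι) :
    P.real {ω | Finset.univ.filter (fun t => ω ∈ E t) = B}
      = ∏ t, if t ∈ B then p else 1 - p := by
  have hset : {ω | Finset.univ.filter (fun t => ω ∈ E t) = B}
      = ⋂ t, if t ∈ B then E t else (E t)ᶜ := by
    ext ω
    simp only [Set.mem_ofPred_eq, Set.mem_iInter, Finset.ext_iff, Finset.mem_filter,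
      Finset.mem_univ, true_and]
    refine forall_congr' fun t => ?_
    by_cases h : t ∈ B <;> simp [h]
  have hmeas : ∀ t, MeasurableSet[MeasurableSpace.generateFrom {E t}]
      (if t ∈ B then E t else (E t)ᶜ) := fun t => by
    have := MeasurableSpace.measurableSet_generateFrom (Set.mem_singleton (E t))
    split_ifs
    exacts [this, this.compl]
  rw [hset, measureReal_def, iIndep.meas_iInter hind hmeas, ENNReal.toReal_prod]
  refine Finset.prod_congr rfl fun t _ => ?_
  split_ifs
  · exact hp t
  · rw [← measureReal_def, probReal_compl_eq_one_sub (hE t), hp t]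

open Classical in
/-- Markov's inequality for `tr exp` of the compensated sum. -/
lemma measureReal_exists_quadForm_gt_le [Fintype ι] {E : ι → Set Ω} {p α c : ℝ} {a : ι → n → ℝ}
    (hE : ∀ t, MeasurableSet (E t)) (hind : iIndepSet E P) (hp : ∀ t, P.real (E t) = p)
    (hp0 : 0 ≤ p) (hp1 : p ≤ 1) (h : ∀ t, IsCompensator p α c (a t)) (s : ℝ) :
    P.real {ω | ∃ v : n → ℝ, s * (v ⬝ᵥ v) <
        ∑ t, ((if ω ∈ E t then α else 0) - c) * (a t ⬝ᵥ v) ^ 2}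
      ≤ Fintype.card n * Real.exp (-s) := by
  set M : Finset ι → Matrix n n ℝ := fun B =>
    0 + ∑ t, ((if t ∈ B then α else 0) - c) • vecMulVec (a t) (a t) with hM
  have hMh : ∀ B, (M B).IsHermitian := fun B =>
    isHermitian_zero.add (isSelfAdjoint_sum _ fun t _ => isHermitian_smul_vecMulVec _ _)
  have hquad : ∀ B v, v ⬝ᵥ M B *ᵥ v
      = ∑ t, ((if t ∈ B then α else 0) - c) * (a t ⬝ᵥ v) ^ 2 := fun B v => by
    rw [hM]
    simp only [zero_add, sum_mulVec, dotProduct_sum, smul_mulVec, dotProduct_smul,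
      dotProduct_vecMulVec_mulVec, smul_eq_mul]
    refine Finset.sum_congr rfl fun t _ => ?_
    rw [dotProduct_comm v, sq]
  set bad : Finset (Finset ι) := Finset.univ.filter fun B =>
    ∃ v : n → ℝ, s * (v ⬝ᵥ v) < v ⬝ᵥ M B *ᵥ v with hbad
  have hsub : {ω | ∃ v : n → ℝ, s * (v ⬝ᵥ v) <
        ∑ t, ((if ω ∈ E t then α else 0) - c) * (a t ⬝ᵥ v) ^ 2}
      ⊆ ⋃ B ∈ bad, {ω | Finset.univ.filter (fun t => ω ∈ E t) = B} := by
    rintro ω ⟨v, hv⟩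
    refine Set.mem_biUnion (x := Finset.univ.filter (fun t => ω ∈ E t)) ?_ rfl
    refine Finset.mem_coe.2 (Finset.mem_filter.2 ⟨Finset.mem_univ _, v, ?_⟩)
    rw [hquad]
    simpa using hv
  have hw : ∀ B : Finset ι, 0 ≤ ∏ t, (if t ∈ B then p else 1 - p) := fun B =>
    Finset.prod_nonneg fun t _ => by split_ifs <;> linarith
  calc _ ≤ P.real (⋃ B ∈ bad, {ω | Finset.univ.filter (fun t => ω ∈ E t) = B}) :=
        measureReal_mono hsub (measure_ne_top _ _)
    _ ≤ ∑ B ∈ bad, P.real {ω | Finset.univ.filter (fun t => ω ∈ E t) = B} :=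
        measureReal_biUnion_finset_le _ _
    _ = ∑ B ∈ bad, ∏ t, (if t ∈ B then p else 1 - p) :=
        Finset.sum_congr rfl fun B _ => measureReal_filter_eq hE hind hp B
    _ ≤ ∑ B ∈ bad, (∏ t, (if t ∈ B then p else 1 - p)) *
          ((NormedSpace.exp (M B)).trace * Real.exp (-s)) := by
        refine Finset.sum_le_sum fun B hB => le_mul_of_one_le_right (hw B) ?_
        obtain ⟨v, hv⟩ := (Finset.mem_filter.1 hB).2
        rw [Real.exp_neg, ← div_eq_mul_inv, one_le_div (Real.exp_pos _)]
        exact exp_le_trace_exp (hMh B) hv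
    _ ≤ ∑ B ∈ (Finset.univ : Finset ι).powerset, (∏ t, (if t ∈ B then p else 1 - p)) *
          ((NormedSpace.exp (M B)).trace * Real.exp (-s)) :=
        Finset.sum_le_sum_of_subset_of_nonneg (by simp) fun B _ _ =>
          mul_nonneg (hw B) (mul_nonneg (trace_exp_nonneg (hMh B)) (Real.exp_pos _).le)
    _ = (∑ B ∈ (Finset.univ : Finset ι).powerset, (∏ t, (if t ∈ B then p else 1 - p)) *
          (NormedSpace.exp (M B)).trace) * Real.exp (-s) := by
        rw [Finset.sum_mul]
        exact Finset.sum_congr rfl fun B _ => by ring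
    _ ≤ Fintype.card n * Real.exp (-s) := by
        refine mul_le_mul_of_nonneg_right ?_ (Real.exp_pos _).le
        refine (sum_powerset_trace_exp_le h hp0 hp1 Finset.univ isHermitian_zero).trans ?_
        rw [NormedSpace.exp_zero, trace_one]

open Classical in
/-- Upper tail of the matrix Chernoff bound for a sum of rank-one matrices `a t (a t)ᵀ` over
independent events. -/
lemma measureReal_chernoff_upper [Fintype ι] {E : ι → Set Ω} {p θ R : ℝ} {a : ι → n → ℝ}
    (hE : ∀ t, MeasurableSet (E t)) (hind : iIndepSet E P) (hp : ∀ t, P.real (E t) = p)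
    (hp0 : 0 ≤ p) (hp1 : p ≤ 1) (hθ : 0 < θ) (ha : ∀ t, a t ⬝ᵥ a t ≤ R) (s : ℝ) :
    P.real {ω | ¬ ∀ v : n → ℝ, ∑ t, (if ω ∈ E t then (a t ⬝ᵥ v) ^ 2 else 0)
        ≤ p * Real.exp (θ * R) * ∑ t, (a t ⬝ᵥ v) ^ 2 + s / θ * (v ⬝ᵥ v)}
      ≤ Fintype.card n * Real.exp (-s) := by
  refine (measureReal_mono ?_).trans (measureReal_exists_quadForm_gt_le hE hind hp hp0 hp1
    (fun t => isCompensator_upper hp0 hθ.le (ha t)) s)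
  intro ω hω
  simp only [Set.mem_ofPred_eq, not_forall, not_le] at hω ⊢
  obtain ⟨v, hv⟩ := hω
  refine ⟨v, ?_⟩
  have e : ∑ t, ((if ω ∈ E t then θ else 0) - p * (θ * Real.exp (θ * R))) * (a t ⬝ᵥ v) ^ 2
      = θ * (∑ t, (if ω ∈ E t then (a t ⬝ᵥ v) ^ 2 else 0)
        - p * Real.exp (θ * R) * ∑ t, (a t ⬝ᵥ v) ^ 2) := by
    rw [Finset.mul_sum, ← Finset.sum_sub_distrib, Finset.mul_sum]
    refine Finset.sum_congr rfl fun t _ => ?_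
    split_ifs <;> ring
  rw [e, ← div_lt_iff₀' hθ]
  have : s * (v ⬝ᵥ v) / θ = s / θ * (v ⬝ᵥ v) := by ring
  linarith

open Classical in
/-- Lower tail of the matrix Chernoff bound for a sum of rank-one matrices `a t (a t)ᵀ` over
independent events. -/
lemma measureReal_chernoff_lower [Fintype ι] {E : ι → Set Ω} {p θ R : ℝ} {a : ι → n → ℝ}
    (hE : ∀ t, MeasurableSet (E t)) (hind : iIndepSet E P) (hp : ∀ t, P.real (E t) = p)
    (hp0 : 0 ≤ p) (hp1 : p ≤ 1) (hθ : 0 < θ) (ha : ∀ t, a t ⬝ᵥ a t ≤ R) (s : ℝ) :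
    P.real {ω | ¬ ∀ v : n → ℝ, p * Real.exp (-(θ * R)) * ∑ t, (a t ⬝ᵥ v) ^ 2
        ≤ ∑ t, (if ω ∈ E t then (a t ⬝ᵥ v) ^ 2 else 0) + s / θ * (v ⬝ᵥ v)}
      ≤ Fintype.card n * Real.exp (-s) := by
  refine (measureReal_mono ?_).trans (measureReal_exists_quadForm_gt_le hE hind hp hp0 hp1
    (fun t => isCompensator_lower hp0 hθ.le (ha t)) s)
  intro ω hω
  simp only [Set.mem_ofPred_eq, not_forall, not_le] at hω ⊢
  obtain ⟨v, hv⟩ := hω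
  refine ⟨v, ?_⟩
  have e : ∑ t, ((if ω ∈ E t then -θ else 0) - -(p * (θ * Real.exp (-(θ * R))))) * (a t ⬝ᵥ v) ^ 2
      = θ * (p * Real.exp (-(θ * R)) * ∑ t, (a t ⬝ᵥ v) ^ 2
        - ∑ t, (if ω ∈ E t then (a t ⬝ᵥ v) ^ 2 else 0)) := by
    rw [Finset.mul_sum, ← Finset.sum_sub_distrib, Finset.mul_sum]
    refine Finset.sum_congr rfl fun t _ => ?_
    split_ifs <;> ring
  rw [e, ← div_lt_iff₀' hθ]
  have : s * (v ⬝ᵥ v) / θ = s / θ * (v ⬝ᵥ v) := by ring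
  linarith

end BernoulliSums

/-! ### Symmetric sampling of index triples -/

section SymmetricSampling

open Matrix

variable {d : ℕ}

/-- The index triples `(j, k, l)` with `j ≤ k ≤ l`, on which a symmetric sampling is independent. -/
abbrev SortedTriple (d : ℕ) : Type :=
  {t : Fin d × Fin d × Fin d // t.1 ≤ t.2.1 ∧ t.2.1 ≤ t.2.2}

/-- The rearrangements of a triple, in the form of a finite set. -/
def rearrangements (t : Fin d × Fin d × Fin d) : Finset (Fin d × Fin d × Fin d) :=
  {(t.1, t.2.1, t.2.2), (t.1, t.2.2, t.2.1), (t.2.1, t.1, t.2.2), (t.2.1, t.2.2, t.1),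
    (t.2.2, t.1, t.2.1), (t.2.2, t.2.1, t.1)}

lemma exists_sortedTriple (x : Fin d × Fin d × Fin d) :
    ∃ t : SortedTriple d, x ∈ rearrangements t.1 := by
  obtain ⟨j, k, l⟩ := x
  rcases le_total j k with h1 | h1 <;> rcases le_total k l with h2 | h2 <;>
    rcases le_total j l with h3 | h3
  · exact ⟨⟨(j, k, l), h1, h2⟩, by simp [rearrangements]⟩
  · exact ⟨⟨(j, k, l), h1, h2⟩, by simp [rearrangements]⟩
  · exact ⟨⟨(j, l, k), h3, h2⟩, by simp [rearrangements]⟩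
  · exact ⟨⟨(l, j, k), h3, h1⟩, by simp [rearrangements]⟩
  · exact ⟨⟨(k, j, l), h1, h3⟩, by simp [rearrangements]⟩
  · exact ⟨⟨(k, l, j), h2, h3⟩, by simp [rearrangements]⟩
  · exact ⟨⟨(l, k, j), h2, h1⟩, by simp [rearrangements]⟩
  · exact ⟨⟨(l, k, j), h2, h1⟩, by simp [rearrangements]⟩

/-- The sorted rearrangement of a triple. -/
noncomputable def sortTriple (x : Fin d × Fin d × Fin d) : SortedTriple d :=
  (exists_sortedTriple x).choose

lemma mem_rearrangements_sortTriple (x : Fin d × Fin d × Fin d) :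
    x ∈ rearrangements (sortTriple x).1 :=
  (exists_sortedTriple x).choose_spec

/-- A function of triples that is invariant under the two adjacent transpositions only depends on
the sorted triple. -/
lemma eq_sortTriple {α : Type*} {F : Fin d × Fin d × Fin d → α}
    (h1 : ∀ j k l, F (j, k, l) = F (k, j, l)) (h2 : ∀ j k l, F (j, k, l) = F (j, l, k))
    (x : Fin d × Fin d × Fin d) : F x = F (sortTriple x).1 := by
  have hx := mem_rearrangements_sortTriple x
  set t := (sortTriple x).1
  obtain ⟨j, k, l⟩ := t
  simp only [rearrangements, Finset.mem_insert, Finset.mem_singleton] at hx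
  rcases hx with h | h | h | h | h | h <;> rw [h]
  · exact h2 _ _ _
  · exact h1 _ _ _
  · exact (h2 _ _ _).trans (h1 _ _ _)
  · exact (h1 _ _ _).trans (h2 _ _ _)
  · exact (h1 _ _ _).trans ((h2 _ _ _).trans (h1 _ _ _))

open Classical in
lemma card_filter_sortTriple_le (t : SortedTriple d) :
    (Finset.univ.filter fun x => sortTriple x = t).card ≤ 6 := by
  have hsub : (Finset.univ.filter fun x => sortTriple x = t) ⊆ rearrangements t.1 := by
    intro x hx
    rw [← (Finset.mem_filter.1 hx).2]
    exact mem_rearrangements_sortTriple x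
  exact (Finset.card_le_card hsub).trans Finset.card_le_six

variable {Ω : Type*} [MeasurableSpace Ω] {P : Measure Ω} {p : ℝ}
  {S : Ω → Set (Fin d × Fin d × Fin d)}

lemma IsSymmetricSampling.swap_left_iff (hS : IsSymmetricSampling P p S) (ω : Ω)
    (j k l : Fin d) : (j, k, l) ∈ S ω ↔ (k, j, l) ∈ S ω :=
  ⟨fun h => (hS.symm ω _ _ _ h).1, fun h => (hS.symm ω _ _ _ h).1⟩

lemma IsSymmetricSampling.swap_right_iff (hS : IsSymmetricSampling P p S) (ω : Ω)
    (j k l : Fin d) : (j, k, l) ∈ S ω ↔ (j, l, k) ∈ S ω :=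
  ⟨fun h => (hS.symm ω _ _ _ h).2, fun h => (hS.symm ω _ _ _ h).2⟩

lemma IsSymmetricSampling.mem_iff_sortTriple (hS : IsSymmetricSampling P p S) (ω : Ω)
    (x : Fin d × Fin d × Fin d) : x ∈ S ω ↔ (sortTriple x).1 ∈ S ω :=
  iff_of_eq (eq_sortTriple (F := fun x => x ∈ S ω)
    (fun j k l => propext (hS.swap_left_iff ω j k l))
    (fun j k l => propext (hS.swap_right_iff ω j k l)) x)

lemma IsSymmetricSampling.le_one [IsProbabilityMeasure P] (hS : IsSymmetricSampling P p S)
    (hd : 0 < d) : p ≤ 1 := by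
  rw [← hS.prob (⟨0, hd⟩, ⟨0, hd⟩, ⟨0, hd⟩) le_rfl le_rfl]
  exact measureReal_le_one

open Classical in
lemma sum_eq_sum_sortTriple (g : Fin d × Fin d × Fin d → ℝ) :
    ∑ x, g x = ∑ t : SortedTriple d, ∑ x with sortTriple x = t, g x :=
  (Finset.sum_fiberwise Finset.univ sortTriple g).symm

open Classical in
lemma IsSymmetricSampling.sum_ite_eq (hS : IsSymmetricSampling P p S) (ω : Ω)
    (g : Fin d × Fin d × Fin d → ℝ) :
    ∑ x, (if x ∈ S ω then g x else 0)
      = ∑ t : SortedTriple d, if t.1 ∈ S ω then ∑ x with sortTriple x = t, g x else 0 := by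
  rw [sum_eq_sum_sortTriple]
  refine Finset.sum_congr rfl fun t _ => ?_
  have hx : ∀ x ∈ Finset.univ.filter (fun x => sortTriple x = t), (x ∈ S ω ↔ t.1 ∈ S ω) :=
    fun x hx => by rw [hS.mem_iff_sortTriple, (Finset.mem_filter.1 hx).2]
  rw [Finset.sum_congr rfl fun x h => if_congr (hx x h) rfl rfl]
  split_ifs <;> simp

variable [IsProbabilityMeasure P]

open Classical in
/-- Chernoff bound for the number of sampled triples, weighted by `w`. -/
lemma IsSymmetricSampling.measureReal_sum_weight (hS : IsSymmetricSampling P p S) (hp0 : 0 ≤ p)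
    (hp1 : p ≤ 1) {w : Fin d × Fin d × Fin d → ℝ} {b : ℝ} (hw : ∀ x, 0 ≤ w x)
    (hb : ∀ x, w x ≤ b) (hb0 : 0 < b) (s : ℝ) :
    P.real {ω | ¬ ∑ x, (if x ∈ S ω then w x else 0) ≤ 3 * p * ∑ x, w x + 6 * b * s}
      ≤ Real.exp (-s) := by
  set W : SortedTriple d → ℝ := fun t => ∑ x with sortTriple x = t, w x with hW
  have hW0 : ∀ t, 0 ≤ W t := fun t => Finset.sum_nonneg fun x _ => hw x
  have hWb : ∀ t, W t ≤ 6 * b := fun t => by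
    have h1 := Finset.sum_le_card_nsmul (Finset.univ.filter fun x => sortTriple x = t) w b
      fun x _ => hb x
    have h2 : ((Finset.univ.filter fun x => sortTriple x = t).card : ℝ) ≤ 6 := by
      exact_mod_cast card_filter_sortTriple_le t
    rw [nsmul_eq_mul] at h1
    nlinarith
  have key := measureReal_chernoff_upper (n := Unit) (P := P)
    (E := fun t : SortedTriple d => {ω | t.1 ∈ S ω}) (p := p) (θ := 1 / (6 * b)) (R := 6 * b)
    (a := fun t _ => √(W t)) (fun t => hS.measurableSet t.1) hS.indep
    (fun t => hS.prob t.1 t.2.1 t.2.2) hp0 hp1 (by positivity)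
    (fun t => by simpa [dotProduct, Real.mul_self_sqrt (hW0 t)] using hWb t) s
  simp only [Fintype.card_unit, Nat.cast_one, one_mul] at key
  refine (measureReal_mono ?_).trans key
  intro ω hω h
  refine hω ?_
  have h1 := h (fun _ => 1)
  simp only [dotProduct, Finset.univ_unique, Finset.sum_const, Finset.card_singleton, one_smul,
    mul_one, Real.sq_sqrt (hW0 _), Set.mem_ofPred_eq] at h1
  rw [hS.sum_ite_eq, sum_eq_sum_sortTriple w]
  have e1 : 1 / (6 * b) * (6 * b) = 1 := by field_simp
  have e2 : s / (1 / (6 * b)) = 6 * b * s := by field_simp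
  rw [e1, e2] at h1
  have h3 : Real.exp 1 ≤ 3 := Real.exp_one_lt_three.le
  have h4 : 0 ≤ p * ∑ t, W t := mul_nonneg hp0 (Finset.sum_nonneg fun t _ => hW0 t)
  nlinarith

variable {n : Type*} [Fintype n] [DecidableEq n]

open Classical in
/-- Two-sided matrix Chernoff bound for a symmetric sampling of the rank-one matrices `a x (a x)ᵀ`.
The triples with the same sorted form are sampled together, which costs the factor `6`. -/
lemma IsSymmetricSampling.measureReal_quadForm (hS : IsSymmetricSampling P p S) (hp0 : 0 ≤ p)
    (hp1 : p ≤ 1) {a : Fin d × Fin d × Fin d → n → ℝ} {R θ : ℝ}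
    (h1 : ∀ j k l, a (j, k, l) = a (k, j, l)) (h2 : ∀ j k l, a (j, k, l) = a (j, l, k))
    (ha : ∀ x, a x ⬝ᵥ a x ≤ R) (hθ : 0 < θ) (s : ℝ) :
    P.real {ω | ¬ ∀ v : n → ℝ,
        p * Real.exp (-(θ * (6 * R))) * ∑ x, (a x ⬝ᵥ v) ^ 2 - s / θ * (v ⬝ᵥ v)
          ≤ ∑ x, (if x ∈ S ω then (a x ⬝ᵥ v) ^ 2 else 0) ∧
        ∑ x, (if x ∈ S ω then (a x ⬝ᵥ v) ^ 2 else 0)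
          ≤ p * Real.exp (θ * (6 * R)) * ∑ x, (a x ⬝ᵥ v) ^ 2 + s / θ * (v ⬝ᵥ v)}
      ≤ 2 * (Fintype.card n * Real.exp (-s)) := by
  set m : SortedTriple d → ℝ := fun t => (Finset.univ.filter fun x => sortTriple x = t).card
    with hm
  have hm0 : ∀ t, 0 ≤ m t := fun t => Nat.cast_nonneg _
  have hm6 : ∀ t, m t ≤ 6 := fun t => by
    change ((Finset.univ.filter fun x => sortTriple x = t).card : ℝ) ≤ 6
    exact_mod_cast card_filter_sortTriple_le t
  have hfib : ∀ (v : n → ℝ) (t : SortedTriple d),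
      ∑ x with sortTriple x = t, (a x ⬝ᵥ v) ^ 2 = ((√(m t) • a t.1) ⬝ᵥ v) ^ 2 := by
    intro v t
    rw [smul_dotProduct, smul_eq_mul, mul_pow, Real.sq_sqrt (hm0 t), hm, ← nsmul_eq_mul,
      ← Finset.sum_const]
    refine Finset.sum_congr rfl fun x hx => ?_
    rw [eq_sortTriple h1 h2 x, (Finset.mem_filter.1 hx).2]
  have hb : ∀ t : SortedTriple d, (√(m t) • a t.1) ⬝ᵥ (√(m t) • a t.1) ≤ 6 * R := fun t => by
    rw [smul_dotProduct, dotProduct_smul, smul_eq_mul, smul_eq_mul, ← mul_assoc,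
      Real.mul_self_sqrt (hm0 t)]
    have h0 : 0 ≤ a t.1 ⬝ᵥ a t.1 := by simpa using dotProduct_star_self_nonneg (a t.1)
    exact mul_le_mul (hm6 t) (ha _) h0 (by norm_num)
  have up := measureReal_chernoff_upper (P := P)
    (E := fun t : SortedTriple d => {ω | t.1 ∈ S ω}) (fun t => hS.measurableSet t.1) hS.indep
    (fun t => hS.prob t.1 t.2.1 t.2.2) hp0 hp1 hθ hb s
  have lo := measureReal_chernoff_lower (P := P)
    (E := fun t : SortedTriple d => {ω | t.1 ∈ S ω}) (fun t => hS.measurableSet t.1) hS.indep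
    (fun t => hS.prob t.1 t.2.1 t.2.2) hp0 hp1 hθ hb s
  rw [two_mul]
  refine (measureReal_mono ?_).trans ((measureReal_union_le _ _).trans (add_le_add lo up))
  intro ω hω
  by_contra hcon
  rw [Set.mem_union, not_or] at hcon
  refine hω fun v => ?_
  have hl := not_not.1 hcon.1 v
  have hu := not_not.1 hcon.2 v
  simp only [← hfib, Set.mem_ofPred_eq, ← sum_eq_sum_sortTriple, ← hS.sum_ite_eq] at hl hu
  exact ⟨by linarith, hu⟩

end SymmetricSampling

/-! ### The Hessian of the loss function -/

section Hessian

open Matrix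

variable {d r : ℕ}

/-- The second Fréchet derivative on the diagonal is the second derivative along a line. -/
lemma iteratedFDeriv_two_eq_of_hasDerivAt {E : Type*} [NormedAddCommGroup E] [NormedSpace ℝ E]
    {f : E → ℝ} (hf : ContDiff ℝ 2 f) (U V : E) {g₁ : ℝ → ℝ} {g₂ : ℝ}
    (h₁ : ∀ t : ℝ, HasDerivAt (fun t : ℝ => f (U + t • V)) (g₁ t) t) (h₂ : HasDerivAt g₁ g₂ 0) :
    iteratedFDeriv ℝ 2 f U ![V, V] = g₂ := by
  have hline : ∀ t : ℝ, HasDerivAt (fun t : ℝ => U + t • V) V t := fun t => by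
    simpa using ((hasDerivAt_id t).smul_const V).const_add U
  have e₁ : g₁ = fun t => fderiv ℝ f (U + t • V) V := by
    ext t
    exact (h₁ t).unique
      (((hf.differentiable (by norm_num)) (U + t • V)).hasFDerivAt.comp_hasDerivAt t (hline t))
  have hf' : Differentiable ℝ (fderiv ℝ f) :=
    (hf.fderiv_right (m := 1) (by norm_num)).differentiable (by norm_num)
  have e₂ : HasDerivAt (fun t : ℝ => fderiv ℝ f (U + t • V) V) (fderiv ℝ (fderiv ℝ f) U V V) 0 := by
    have h := (hf' (U + (0 : ℝ) • V)).hasFDerivAt.comp_hasDerivAt (0 : ℝ) (hline 0)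
    rw [zero_smul, add_zero] at h
    exact h.clm_apply (hasDerivAt_const (0 : ℝ) V) |>.congr_deriv (by simp)
  rw [iteratedFDeriv_two_apply]
  rw [e₁] at h₂
  exact (h₂.unique e₂).symm

/-- The entries of `∑ i, uᵢ ⊗ uᵢ ⊗ uᵢ`. -/
def cpEntry (U : Matrix (Fin d) (Fin r) ℝ) (x : Fin d × Fin d × Fin d) : ℝ :=
  ∑ i, U x.1 i * U x.2.1 i * U x.2.2 i

/-- The entries of the first derivative `∑ i, (vᵢ ⊗ uᵢ ⊗ uᵢ + uᵢ ⊗ vᵢ ⊗ uᵢ + uᵢ ⊗ uᵢ ⊗ vᵢ)` of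
the tensor in the direction `V`. -/
def tangentEntry (U V : Matrix (Fin d) (Fin r) ℝ) (x : Fin d × Fin d × Fin d) : ℝ :=
  ∑ i, (V x.1 i * U x.2.1 i * U x.2.2 i + U x.1 i * V x.2.1 i * U x.2.2 i
    + U x.1 i * U x.2.1 i * V x.2.2 i)

/-- The entries of one half of the second derivative of the tensor in the direction `V`, which is
`∑ i, (vᵢ ⊗ vᵢ ⊗ uᵢ + vᵢ ⊗ uᵢ ⊗ vᵢ + uᵢ ⊗ vᵢ ⊗ vᵢ)`. -/
def curvatureEntry (U V : Matrix (Fin d) (Fin r) ℝ) (x : Fin d × Fin d × Fin d) : ℝ :=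
  ∑ i, (V x.1 i * V x.2.1 i * U x.2.2 i + V x.1 i * U x.2.1 i * V x.2.2 i
    + U x.1 i * V x.2.1 i * V x.2.2 i)

open Classical in
lemma fClean_eq (p : ℝ) (S : Set (Fin d × Fin d × Fin d)) (Ustar U : Matrix (Fin d) (Fin r) ℝ) :
    fClean p S Ustar U
      = 1 / (6 * p) * ∑ x, if x ∈ S then (cpEntry U x - cpEntry Ustar x) ^ 2 else 0 := by
  rw [fClean, Tensor3.frobSq]
  simp only [Fintype.sum_prod_type]
  congr 1
  refine Finset.sum_congr rfl fun j _ => Finset.sum_congr rfl fun k _ =>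
    Finset.sum_congr rfl fun l _ => ?_
  have h : ∀ U : Matrix (Fin d) (Fin r) ℝ, cpTensor U j k l = cpEntry U (j, k, l) := fun U => by
    simp [cpTensor, cpEntry, Tensor3.outer, Finset.sum_apply, Matrix.col_apply]
  by_cases hS : (j, k, l) ∈ S <;> simp [Tensor3.proj, hS, h]

lemma contDiff_cpEntry (x : Fin d × Fin d × Fin d) {m : WithTop ℕ∞} :
    ContDiff ℝ m (fun U : Matrix (Fin d) (Fin r) ℝ => cpEntry U x) := by
  have hentry : ∀ j i, ContDiff ℝ m (fun U : Matrix (Fin d) (Fin r) ℝ => U j i) := fun j i =>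
    (LinearMap.toContinuousLinearMap (Matrix.entryLinearMap ℝ ℝ j i)).contDiff
  exact ContDiff.sum fun i _ => ((hentry _ i).mul (hentry _ i)).mul (hentry _ i)

lemma contDiff_fClean (p : ℝ) (S : Set (Fin d × Fin d × Fin d))
    (Ustar : Matrix (Fin d) (Fin r) ℝ) {m : WithTop ℕ∞} : ContDiff ℝ m (fClean p S Ustar) := by
  classical
  rw [funext (fClean_eq p S Ustar)]
  refine contDiff_const.mul (ContDiff.sum fun x _ => ?_)
  by_cases hx : x ∈ S
  · simpa only [hx, if_true] using ((contDiff_cpEntry x).sub contDiff_const).pow 2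
  · simpa only [hx, if_false] using contDiff_const

lemma hasDerivAt_entry_line (U V : Matrix (Fin d) (Fin r) ℝ) (j : Fin d) (i : Fin r) (t : ℝ) :
    HasDerivAt (fun t : ℝ => (U + t • V) j i) (V j i) t := by
  simpa using ((hasDerivAt_id t).mul_const (V j i)).const_add (U j i)

lemma hasDerivAt_cpEntry_line (U V : Matrix (Fin d) (Fin r) ℝ) (x : Fin d × Fin d × Fin d)
    (t : ℝ) :
    HasDerivAt (fun t : ℝ => cpEntry (U + t • V) x) (tangentEntry (U + t • V) V x) t := by
  refine HasDerivAt.fun_sum fun i _ => ?_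
  refine (((hasDerivAt_entry_line U V x.1 i t).mul (hasDerivAt_entry_line U V x.2.1 i t)).mul
    (hasDerivAt_entry_line U V x.2.2 i t)).congr_deriv ?_
  rw [Pi.mul_apply]
  ring

lemma hasDerivAt_tangentEntry_line (U V : Matrix (Fin d) (Fin r) ℝ)
    (x : Fin d × Fin d × Fin d) (t : ℝ) :
    HasDerivAt (fun t : ℝ => tangentEntry (U + t • V) V x)
      (2 * curvatureEntry (U + t • V) V x) t := by
  rw [curvatureEntry, Finset.mul_sum]
  refine HasDerivAt.fun_sum fun i _ => ?_
  have h1 := hasDerivAt_entry_line U V x.1 i t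
  have h2 := hasDerivAt_entry_line U V x.2.1 i t
  have h3 := hasDerivAt_entry_line U V x.2.2 i t
  refine ((((h2.const_mul (V x.1 i)).mul h3).add ((h1.mul_const (V x.2.1 i)).mul h3)).add
    ((h1.mul h2).mul_const (V x.2.2 i))).congr_deriv ?_
  ring

open Classical in
lemma hessianForm_fClean (p : ℝ) (S : Set (Fin d × Fin d × Fin d))
    (Ustar U V : Matrix (Fin d) (Fin r) ℝ) :
    hessianForm (fClean p S Ustar) U V
      = 1 / (3 * p) * ∑ x, (if x ∈ S then tangentEntry U V x ^ 2 else 0)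
        + 2 / (3 * p) * ∑ x, (if x ∈ S then
            (cpEntry U x - cpEntry Ustar x) * curvatureEntry U V x else 0) := by
  set χ : Fin d × Fin d × Fin d → ℝ := fun x => if x ∈ S then 1 else 0 with hχ
  have hχ' : ∀ (x : Fin d × Fin d × Fin d) (y : ℝ), (if x ∈ S then y else 0) = χ x * y := by
    intro x y
    simp [hχ]
  have h₁ : ∀ t : ℝ, HasDerivAt (fun t : ℝ => fClean p S Ustar (U + t • V))
      (1 / (6 * p) * ∑ x, χ x * (2 * ((cpEntry (U + t • V) x - cpEntry Ustar x)
        * tangentEntry (U + t • V) V x))) t := by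
    intro t
    simp only [fClean_eq, hχ']
    refine HasDerivAt.const_mul _ (HasDerivAt.fun_sum fun x _ => HasDerivAt.const_mul _ ?_)
    refine (((hasDerivAt_cpEntry_line U V x t).sub_const (cpEntry Ustar x)).pow 2).congr_deriv ?_
    simp only [Nat.cast_ofNat, Nat.add_one_sub_one, pow_one]
    ring
  have h₂ : HasDerivAt (fun t : ℝ => 1 / (6 * p) * ∑ x, χ x *
        (2 * ((cpEntry (U + t • V) x - cpEntry Ustar x) * tangentEntry (U + t • V) V x)))
      (1 / (6 * p) * ∑ x, χ x * (2 * (tangentEntry U V x * tangentEntry U V x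
        + (cpEntry U x - cpEntry Ustar x) * (2 * curvatureEntry U V x)))) 0 := by
    refine HasDerivAt.const_mul _ (HasDerivAt.fun_sum fun x _ => HasDerivAt.const_mul _
      (HasDerivAt.const_mul _ ?_))
    have := ((hasDerivAt_cpEntry_line U V x 0).sub_const (cpEntry Ustar x)).mul
      (hasDerivAt_tangentEntry_line U V x 0)
    simp only [zero_smul, add_zero] at this
    exact this
  rw [hessianForm, iteratedFDeriv_two_eq_of_hasDerivAt (contDiff_fClean p S Ustar) U V h₁ h₂]
  simp only [hχ', Finset.mul_sum, ← Finset.sum_add_distrib]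
  refine Finset.sum_congr rfl fun x _ => ?_
  rcases eq_or_ne p 0 with rfl | hp
  · simp
  · field_simp
    ring

end Hessian

/-! ### Tangent vectors: conditioning and perturbation -/

section Deterministic

variable {d r : ℕ}

lemma sum_mul_mul_eq {ι : Type*} [Fintype ι] (f g h : ι → ℝ) :
    ∑ x : ι × ι × ι, f x.1 * g x.2.1 * h x.2.2 = (∑ j, f j) * (∑ j, g j) * ∑ j, h j := by
  simp only [Fintype.sum_prod_type, ← Finset.mul_sum, ← Finset.sum_mul]

lemma sum_symmetrized_mul_symmetrized {ι : Type*} [Fintype ι] (u v u' v' : ι → ℝ) :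
    ∑ x : ι × ι × ι, (v x.1 * u x.2.1 * u x.2.2 + u x.1 * v x.2.1 * u x.2.2
        + u x.1 * u x.2.1 * v x.2.2)
      * (v' x.1 * u' x.2.1 * u' x.2.2 + u' x.1 * v' x.2.1 * u' x.2.2
        + u' x.1 * u' x.2.1 * v' x.2.2)
      = 3 * (∑ j, v j * v' j) * (∑ j, u j * u' j) ^ 2
        + 6 * (∑ j, v j * u' j) * (∑ j, u j * v' j) * (∑ j, u j * u' j) := by
  have e : ∀ a b c a' b' c' : ι → ℝ,
      ∑ x : ι × ι × ι, (a x.1 * b x.2.1 * c x.2.2) * (a' x.1 * b' x.2.1 * c' x.2.2)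
        = (∑ j, a j * a' j) * (∑ j, b j * b' j) * ∑ j, c j * c' j := by
    intro a b c a' b' c'
    rw [← sum_mul_mul_eq]
    exact Finset.sum_congr rfl fun x _ => by ring
  simp only [add_mul, mul_add, Finset.sum_add_distrib, e]
  ring

lemma abs_sum_mul_le_half {ι : Type*} [Fintype ι] (v w : ι → ℝ) :
    |∑ j, v j * w j| ≤ (∑ j, v j ^ 2 + ∑ j, w j ^ 2) / 2 := by
  rw [← Finset.sum_add_distrib, Finset.sum_div]
  refine (Finset.abs_sum_le_sum_abs _ _).trans (Finset.sum_le_sum fun j _ => ?_)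
  rw [abs_mul]
  nlinarith [sq_nonneg (|v j| - |w j|), sq_abs (v j), sq_abs (w j)]

/-- At nearly orthogonal columns, the tangent space embedding `V ↦ ∑ i, (vᵢ ⊗ uᵢ ⊗ uᵢ + ⋯)` is
well conditioned: the terms with equal column indices give between `3 m⁴` and `9 σ⁴`, and the
others are bounded by the coherence `g`. -/
lemma abs_sum_tangentEntry_sq_sub_le {u : Matrix (Fin d) (Fin r) ℝ} {σ g : ℝ} (hg0 : 0 ≤ g)
    (hg1 : g ≤ 1) (hσ : ∀ i, ∑ j, u j i ^ 2 ≤ σ ^ 2)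
    (hcoh : ∀ i i', i ≠ i' → |∑ j, u j i * u j i'| ≤ g * σ ^ 2) (V : Matrix (Fin d) (Fin r) ℝ) :
    |∑ x, tangentEntry u V x ^ 2 - ∑ i, (3 * (∑ j, V j i ^ 2) * (∑ j, u j i ^ 2) ^ 2
        + 6 * (∑ j, V j i * u j i) ^ 2 * (∑ j, u j i ^ 2))|
      ≤ 9 * g * r * σ ^ 4 * ∑ i, ∑ j, V j i ^ 2 := by
  set a : Fin r → ℝ := fun i => ∑ j, V j i ^ 2 with ha
  have ha0 : ∀ i, 0 ≤ a i := fun i => Finset.sum_nonneg fun j _ => sq_nonneg _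
  set q : Fin r → Fin r → ℝ := fun i i' =>
    3 * (∑ j, V j i * V j i') * (∑ j, u j i * u j i') ^ 2
      + 6 * (∑ j, V j i * u j i') * (∑ j, u j i * V j i') * (∑ j, u j i * u j i') with hq
  have hsum : ∑ x, tangentEntry u V x ^ 2 = ∑ i, ∑ i', q i i' := by
    simp only [tangentEntry, sq, Finset.sum_mul_sum]
    rw [Finset.sum_comm]
    refine Finset.sum_congr rfl fun i _ => ?_
    rw [Finset.sum_comm]
    refine Finset.sum_congr rfl fun i' _ => ?_
    exact (sum_symmetrized_mul_symmetrized (fun j => u j i) (fun j => V j i) (fun j => u j i')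
      (fun j => V j i')).trans (by rw [hq])
  have hdiag : ∀ i, 3 * a i * (∑ j, u j i ^ 2) ^ 2
      + 6 * (∑ j, V j i * u j i) ^ 2 * (∑ j, u j i ^ 2) = q i i := fun i => by
    have e1 : ∑ j, u j i * V j i = ∑ j, V j i * u j i :=
      Finset.sum_congr rfl fun j _ => mul_comm _ _
    simp only [hq, e1, ha, sq]
    ring
  have hoff : ∀ i i', i ≠ i' → |q i i'| ≤ 9 * g * σ ^ 4 * ((a i + a i') / 2) := by
    intro i i' hii
    have hz := hcoh i i' hii
    set z := ∑ j, u j i * u j i'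
    have hs2 : 0 ≤ σ ^ 2 := sq_nonneg σ
    have hA : 0 ≤ (a i + a i') / 2 := by linarith [ha0 i, ha0 i']
    have h1 : |∑ j, V j i * V j i'| ≤ (a i + a i') / 2 := abs_sum_mul_le_half _ _
    have hz2 : z ^ 2 ≤ g * σ ^ 4 := by
      rw [← sq_abs]
      calc |z| ^ 2 ≤ (g * σ ^ 2) ^ 2 := pow_le_pow_left₀ (abs_nonneg _) hz 2
        _ = g * (g * σ ^ 4) := by ring
        _ ≤ 1 * (g * σ ^ 4) := mul_le_mul_of_nonneg_right hg1 (by positivity)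
        _ = g * σ ^ 4 := one_mul _
    have h2 : (∑ j, V j i * u j i') ^ 2 ≤ a i * σ ^ 2 :=
      (Finset.sum_mul_sq_le_sq_mul_sq _ _ _).trans (mul_le_mul_of_nonneg_left (hσ i') (ha0 i))
    have h3 : (∑ j, u j i * V j i') ^ 2 ≤ σ ^ 2 * a i' :=
      (Finset.sum_mul_sq_le_sq_mul_sq _ _ _).trans (mul_le_mul_of_nonneg_right (hσ i) (ha0 i'))
    have h4 : |(∑ j, V j i * u j i') * (∑ j, u j i * V j i')| ≤ σ ^ 2 * ((a i + a i') / 2) := by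
      rw [abs_mul]
      nlinarith [sq_nonneg (|∑ j, V j i * u j i'| - |∑ j, u j i * V j i'|),
        sq_abs (∑ j, V j i * u j i'), sq_abs (∑ j, u j i * V j i')]
    have t1 : |(∑ j, V j i * V j i') * z ^ 2| ≤ (a i + a i') / 2 * (g * σ ^ 4) := by
      rw [abs_mul, abs_of_nonneg (sq_nonneg z)]
      exact mul_le_mul h1 hz2 (sq_nonneg _) hA
    have t2 : |(∑ j, V j i * u j i') * (∑ j, u j i * V j i') * z|
        ≤ σ ^ 2 * ((a i + a i') / 2) * (g * σ ^ 2) := by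
      rw [abs_mul]
      exact mul_le_mul h4 hz (abs_nonneg _) (by positivity)
    have e : q i i' = 3 * ((∑ j, V j i * V j i') * z ^ 2)
        + 6 * ((∑ j, V j i * u j i') * (∑ j, u j i * V j i') * z) := by
      simp only [hq]; ring
    rw [e]
    rw [abs_le] at t1 t2 ⊢
    constructor <;> nlinarith
  have hterm : ∀ i, |∑ i', q i i' - q i i|
      ≤ ∑ i', 9 * g * σ ^ 4 * ((a i + a i') / 2) := by
    intro i
    rw [← Finset.add_sum_erase _ _ (Finset.mem_univ i), add_sub_cancel_left]
    refine (Finset.abs_sum_le_sum_abs _ _).trans ((Finset.sum_le_sum fun i' hi' =>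
      hoff i i' (Finset.ne_of_mem_erase hi').symm).trans
      (Finset.sum_le_sum_of_subset_of_nonneg (Finset.erase_subset _ _) fun i' _ _ => ?_))
    have := ha0 i
    have := ha0 i'
    positivity
  calc _ = |∑ i, (∑ i', q i i' - q i i)| := by
        rw [hsum, Finset.sum_sub_distrib, ← Finset.sum_congr rfl fun i _ => hdiag i]
    _ ≤ ∑ i, ∑ i', 9 * g * σ ^ 4 * ((a i + a i') / 2) :=
        (Finset.abs_sum_le_sum_abs _ _).trans (Finset.sum_le_sum fun i _ => hterm i)
    _ = 9 * g * r * σ ^ 4 * ∑ i, a i := by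
        simp only [← Finset.mul_sum, ← Finset.sum_div, Finset.sum_add_distrib, Finset.sum_const,
          Finset.card_univ, Fintype.card_fin, nsmul_eq_mul]
        ring

/-- Bounds for `∑ x, D x ^ 2` on the tangent space at nearly orthogonal columns. -/
lemma sum_tangentEntry_sq_bounds {u : Matrix (Fin d) (Fin r) ℝ} {σ m g c : ℝ} (hg0 : 0 ≤ g)
    (hg1 : g ≤ 1) (hgr : g * r ≤ c) (hσ : ∀ i, ∑ j, u j i ^ 2 ≤ σ ^ 2)
    (hmu : ∀ i, m ^ 2 ≤ ∑ j, u j i ^ 2)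
    (hcoh : ∀ i i', i ≠ i' → |∑ j, u j i * u j i'| ≤ g * σ ^ 2) (V : Matrix (Fin d) (Fin r) ℝ) :
    (3 * m ^ 4 - 9 * c * σ ^ 4) * ∑ j, ∑ i, V j i ^ 2 ≤ ∑ x, tangentEntry u V x ^ 2 ∧
      ∑ x, tangentEntry u V x ^ 2 ≤ (9 * σ ^ 4 + 9 * c * σ ^ 4) * ∑ j, ∑ i, V j i ^ 2 := by
  have h := abs_le.1 (abs_sum_tangentEntry_sq_sub_le hg0 hg1 hσ hcoh V)
  rw [Finset.sum_comm (f := fun j i => V j i ^ 2)]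
  set N := ∑ i, ∑ j, V j i ^ 2 with hN
  have hN0 : 0 ≤ N := Finset.sum_nonneg fun i _ => Finset.sum_nonneg fun j _ => sq_nonneg _
  have hlo : 3 * m ^ 4 * N ≤ ∑ i, (3 * (∑ j, V j i ^ 2) * (∑ j, u j i ^ 2) ^ 2
      + 6 * (∑ j, V j i * u j i) ^ 2 * (∑ j, u j i ^ 2)) := by
    rw [hN, Finset.mul_sum]
    refine Finset.sum_le_sum fun i _ => ?_
    have h1 : m ^ 4 ≤ (∑ j, u j i ^ 2) ^ 2 := by
      have := pow_le_pow_left₀ (sq_nonneg m) (hmu i) 2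
      linarith [this, (by ring : (m ^ 2) ^ 2 = m ^ 4)]
    have h2 : 0 ≤ ∑ j, V j i ^ 2 := Finset.sum_nonneg fun j _ => sq_nonneg _
    have h3 : 0 ≤ ∑ j, u j i ^ 2 := Finset.sum_nonneg fun j _ => sq_nonneg _
    have h4 : 0 ≤ (∑ j, V j i * u j i) ^ 2 * ∑ j, u j i ^ 2 := by positivity
    nlinarith
  have hhi : ∑ i, (3 * (∑ j, V j i ^ 2) * (∑ j, u j i ^ 2) ^ 2
      + 6 * (∑ j, V j i * u j i) ^ 2 * (∑ j, u j i ^ 2)) ≤ 9 * σ ^ 4 * N := by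
    rw [hN, Finset.mul_sum]
    refine Finset.sum_le_sum fun i _ => ?_
    have h2 : 0 ≤ ∑ j, V j i ^ 2 := Finset.sum_nonneg fun j _ => sq_nonneg _
    have h3 : 0 ≤ ∑ j, u j i ^ 2 := Finset.sum_nonneg fun j _ => sq_nonneg _
    have h1 : (∑ j, u j i ^ 2) ^ 2 ≤ σ ^ 4 := by
      have := pow_le_pow_left₀ h3 (hσ i) 2
      linarith [this, (by ring : (σ ^ 2) ^ 2 = σ ^ 4)]
    have h4 : (∑ j, V j i * u j i) ^ 2 ≤ (∑ j, V j i ^ 2) * ∑ j, u j i ^ 2 :=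
      Finset.sum_mul_sq_le_sq_mul_sq _ _ _
    have h5 := mul_le_mul_of_nonneg_right h4 h3
    nlinarith [mul_le_mul_of_nonneg_left h1 h2]
  have herr : 9 * g * r * σ ^ 4 * N ≤ 9 * c * σ ^ 4 * N := by
    have : 0 ≤ σ ^ 4 * N := by positivity
    nlinarith
  constructor
  · linarith [h.1]
  · linarith [h.2]

lemma abs_sum_mul_mul_le {ι : Type*} [Fintype ι] {a b c : ι → ℝ} {ρ C : ℝ} (hρ : 0 ≤ ρ)
    (hb : ∑ i, b i ^ 2 ≤ ρ ^ 2) (hC : ∀ i, |c i| ≤ C) (hC0 : 0 ≤ C) :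
    |∑ i, a i * b i * c i| ≤ C * ρ * √(∑ i, a i ^ 2) := by
  have h1 : |∑ i, a i * b i * c i| ≤ C * ∑ i, |a i| * |b i| := by
    rw [Finset.mul_sum]
    refine (Finset.abs_sum_le_sum_abs _ _).trans (Finset.sum_le_sum fun i _ => ?_)
    rw [abs_mul, abs_mul, mul_comm]
    exact mul_le_mul_of_nonneg_right (hC i) (by positivity)
  have h2 : ∑ i, |a i| * |b i| ≤ √(∑ i, a i ^ 2) * ρ := by
    refine (Real.sum_mul_le_sqrt_mul_sqrt _ _ _).trans ?_
    simp only [sq_abs]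
    exact mul_le_mul_of_nonneg_left ((Real.sqrt_le_left hρ).2 hb) (Real.sqrt_nonneg _)
  calc _ ≤ C * ∑ i, |a i| * |b i| := h1
    _ ≤ C * (√(∑ i, a i ^ 2) * ρ) := mul_le_mul_of_nonneg_left h2 hC0
    _ = _ := by ring

variable {u U V : Matrix (Fin d) (Fin r) ℝ} {B ρ : ℝ}

lemma abs_le_of_sum_sq_le {ι : Type*} [Fintype ι] {b : ι → ℝ} (hρ : 0 ≤ ρ)
    (hb : ∑ i, b i ^ 2 ≤ ρ ^ 2) (i : ι) : |b i| ≤ ρ :=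
  abs_le_of_sq_le_sq ((Finset.single_le_sum (f := fun i => b i ^ 2) (fun _ _ => sq_nonneg _)
    (Finset.mem_univ i)).trans hb) hρ

lemma abs_entry_le_two_mul (hρ : 0 ≤ ρ) (hρB : ρ ≤ B) (hu : ∀ j i, |u j i| ≤ B)
    (hU : ∀ j, ∑ i, (U j i - u j i) ^ 2 ≤ ρ ^ 2) (j : Fin d) (i : Fin r) : |U j i| ≤ 2 * B := by
  have h1 : |U j i - u j i| ≤ ρ := abs_le_of_sum_sq_le hρ (hU j) i
  rw [abs_le] at h1
  have h2 := abs_le.1 (hu j i)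
  rw [abs_le]
  constructor <;> linarith

/-- Perturbation of the tangent vector when the base point moves from `u` to `U`. -/
lemma sq_tangentEntry_sub_le (hρ : 0 ≤ ρ) (hρB : ρ ≤ B) (hu : ∀ j i, |u j i| ≤ B)
    (hU : ∀ j, ∑ i, (U j i - u j i) ^ 2 ≤ ρ ^ 2) (x : Fin d × Fin d × Fin d) :
    (tangentEntry U V x - tangentEntry u V x) ^ 2 ≤ 27 * B ^ 2 * ρ ^ 2 *
      (∑ i, V x.1 i ^ 2 + ∑ i, V x.2.1 i ^ 2 + ∑ i, V x.2.2 i ^ 2) := by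
  have hB : 0 ≤ B := hρ.trans hρB
  have hUB := abs_entry_le_two_mul hρ hρB hu hU
  have key : ∀ j k l, |∑ i, V j i * (U k i * U l i - u k i * u l i)|
      ≤ 3 * B * ρ * √(∑ i, V j i ^ 2) := by
    intro j k l
    have e : ∑ i, V j i * (U k i * U l i - u k i * u l i)
        = ∑ i, V j i * (U k i - u k i) * U l i + ∑ i, V j i * (U l i - u l i) * u k i := by
      rw [← Finset.sum_add_distrib]
      exact Finset.sum_congr rfl fun i _ => by ring
    rw [e]
    have h1 := abs_sum_mul_mul_le (a := fun i => V j i) hρ (hU k) (hUB l) (by linarith)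
    have h2 := abs_sum_mul_mul_le (a := fun i => V j i) hρ (hU l) (hu k) hB
    exact (abs_add_le _ _).trans ((add_le_add h1 h2).trans (le_of_eq (by ring)))
  have e : tangentEntry U V x - tangentEntry u V x
      = ∑ i, V x.1 i * (U x.2.1 i * U x.2.2 i - u x.2.1 i * u x.2.2 i)
        + ∑ i, V x.2.1 i * (U x.1 i * U x.2.2 i - u x.1 i * u x.2.2 i)
        + ∑ i, V x.2.2 i * (U x.1 i * U x.2.1 i - u x.1 i * u x.2.1 i) := by
    simp only [tangentEntry, ← Finset.sum_add_distrib, ← Finset.sum_sub_distrib]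
    exact Finset.sum_congr rfl fun i _ => by ring
  have hsq : ∀ j k l, (∑ i, V j i * (U k i * U l i - u k i * u l i)) ^ 2
      ≤ 9 * B ^ 2 * ρ ^ 2 * ∑ i, V j i ^ 2 := by
    intro j k l
    rw [← sq_abs]
    refine (pow_le_pow_left₀ (abs_nonneg _) (key j k l) 2).trans (le_of_eq ?_)
    rw [mul_pow, Real.sq_sqrt (Finset.sum_nonneg fun i _ => sq_nonneg _)]
    ring
  rw [e]
  have h1 := hsq x.1 x.2.1 x.2.2
  have h2 := hsq x.2.1 x.1 x.2.2
  have h3 := hsq x.2.2 x.1 x.2.1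
  generalize ∑ i, V x.1 i * (U x.2.1 i * U x.2.2 i - u x.2.1 i * u x.2.2 i) = α at *
  generalize ∑ i, V x.2.1 i * (U x.1 i * U x.2.2 i - u x.1 i * u x.2.2 i) = β at *
  generalize ∑ i, V x.2.2 i * (U x.1 i * U x.2.1 i - u x.1 i * u x.2.1 i) = γ at *
  nlinarith [sq_nonneg (α - β), sq_nonneg (β - γ), sq_nonneg (α - γ)]

lemma abs_cpEntry_sub_le (hρ : 0 ≤ ρ) (hρB : ρ ≤ B) (hu : ∀ j i, |u j i| ≤ B)
    (hU : ∀ j, ∑ i, (U j i - u j i) ^ 2 ≤ ρ ^ 2) (x : Fin d × Fin d × Fin d) :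
    |cpEntry U x - cpEntry u x| ≤ 7 * B ^ 2 * ρ * √r := by
  have hB : 0 ≤ B := hρ.trans hρB
  have hUB := abs_entry_le_two_mul hρ hρB hu hU
  have h1 : ∀ (j : Fin d) (c : Fin r → ℝ) (C : ℝ), (∀ i, |c i| ≤ C) → 0 ≤ C →
      |∑ i, (U j i - u j i) * c i| ≤ C * ρ * √r := by
    intro j c C hc hC
    have := abs_sum_mul_mul_le (a := fun _ => 1) hρ (hU j) hc hC
    simpa using this
  have hmul : ∀ {a b α β : ℝ}, |a| ≤ α → |b| ≤ β → 0 ≤ α → |a * b| ≤ α * β :=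
    fun {a b α β} ha hb h0 => by
      rw [abs_mul]; exact mul_le_mul ha hb (abs_nonneg _) h0
  have e : cpEntry U x - cpEntry u x
      = ∑ i, (U x.1 i - u x.1 i) * (U x.2.1 i * U x.2.2 i)
        + ∑ i, (U x.2.1 i - u x.2.1 i) * (u x.1 i * U x.2.2 i)
        + ∑ i, (U x.2.2 i - u x.2.2 i) * (u x.1 i * u x.2.1 i) := by
    simp only [cpEntry, ← Finset.sum_add_distrib, ← Finset.sum_sub_distrib]
    exact Finset.sum_congr rfl fun i _ => by ring
  rw [e]
  have k1 := h1 x.1 (fun i => U x.2.1 i * U x.2.2 i) (2 * B * (2 * B))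
    (fun i => hmul (hUB _ i) (hUB _ i) (by linarith)) (by positivity)
  have k2 := h1 x.2.1 (fun i => u x.1 i * U x.2.2 i) (B * (2 * B))
    (fun i => hmul (hu _ i) (hUB _ i) hB) (by positivity)
  have k3 := h1 x.2.2 (fun i => u x.1 i * u x.2.1 i) (B * B)
    (fun i => hmul (hu _ i) (hu _ i) hB) (by positivity)
  refine (abs_add_three _ _ _).trans ((add_le_add (add_le_add k1 k2) k3).trans (le_of_eq ?_))
  ring

section SymmetricWeights

variable {χ : Fin d × Fin d × Fin d → ℝ}

lemma sum_symm_swap_left (h : ∀ j k l, χ (j, k, l) = χ (k, j, l))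
    (F : Fin d × Fin d × Fin d → ℝ) :
    ∑ x, χ x * F x = ∑ x, χ x * F (x.2.1, x.1, x.2.2) := by
  simp only [Fintype.sum_prod_type]
  rw [Finset.sum_comm]
  exact Finset.sum_congr rfl fun j _ => Finset.sum_congr rfl fun k _ =>
    Finset.sum_congr rfl fun l _ => by rw [h]

lemma sum_symm_swap_right (h : ∀ j k l, χ (j, k, l) = χ (j, l, k))
    (F : Fin d × Fin d × Fin d → ℝ) :
    ∑ x, χ x * F x = ∑ x, χ x * F (x.1, x.2.2, x.2.1) := by
  simp only [Fintype.sum_prod_type]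
  refine Finset.sum_congr rfl fun j _ => ?_
  rw [Finset.sum_comm]
  exact Finset.sum_congr rfl fun k _ => Finset.sum_congr rfl fun l _ => by rw [h]

lemma sum_weight_mul_fst_le {f : Fin d → ℝ} (hf : ∀ j, 0 ≤ f j)
    {w : Fin d → ℝ} {G : ℝ} (hG : ∀ j, ∑ x, χ x * (if x.1 = j then w x.2.2 else 0) ≤ G) :
    ∑ x, χ x * (f x.1 * w x.2.2) ≤ G * ∑ j, f j := by
  have e : ∑ x, χ x * (f x.1 * w x.2.2)
      = ∑ j, f j * ∑ x, χ x * (if x.1 = j then w x.2.2 else 0) := by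
    simp only [Finset.mul_sum]
    rw [Finset.sum_comm]
    refine Finset.sum_congr rfl fun x _ => ?_
    rw [Finset.sum_eq_single x.1]
    · rw [if_pos rfl]; ring
    · intro j _ hj
      rw [if_neg hj.symm]; ring
    · simp
  rw [e, mul_comm G, Finset.sum_mul]
  exact Finset.sum_le_sum fun j _ => mul_le_mul_of_nonneg_left (hG j) (hf j)

lemma sum_weight_mul_sq_tangentEntry_sub_le (hχ : ∀ x, 0 ≤ χ x)
    (h₁ : ∀ j k l, χ (j, k, l) = χ (k, j, l)) (h₂ : ∀ j k l, χ (j, k, l) = χ (j, l, k))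
    (hρ : 0 ≤ ρ) (hρB : ρ ≤ B) (hu : ∀ j i, |u j i| ≤ B)
    (hU : ∀ j, ∑ i, (U j i - u j i) ^ 2 ≤ ρ ^ 2) {G : ℝ}
    (hG : ∀ j, ∑ x, χ x * (if x.1 = j then 1 else 0) ≤ G) :
    ∑ x, χ x * (tangentEntry U V x - tangentEntry u V x) ^ 2
      ≤ 81 * B ^ 2 * ρ ^ 2 * G * ∑ j, ∑ i, V j i ^ 2 := by
  set Y : Fin d → ℝ := fun j => ∑ i, V j i ^ 2 with hY
  have hY0 : ∀ j, 0 ≤ Y j := fun j => Finset.sum_nonneg fun i _ => sq_nonneg _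
  have hfst : ∑ x, χ x * Y x.1 ≤ G * ∑ j, Y j := by
    simpa using sum_weight_mul_fst_le hY0 (w := fun _ => 1) hG
  have hsnd : ∑ x, χ x * Y x.2.1 = ∑ x, χ x * Y x.1 :=
    sum_symm_swap_left h₁ fun x => Y x.2.1
  have hthd : ∑ x, χ x * Y x.2.2 = ∑ x, χ x * Y x.2.1 :=
    sum_symm_swap_right h₂ fun x => Y x.2.2
  calc _ ≤ ∑ x, χ x * (27 * B ^ 2 * ρ ^ 2 * (Y x.1 + Y x.2.1 + Y x.2.2)) :=
        Finset.sum_le_sum fun x _ =>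
          mul_le_mul_of_nonneg_left (sq_tangentEntry_sub_le hρ hρB hu hU x) (hχ x)
    _ = 27 * B ^ 2 * ρ ^ 2 *
          (∑ x, χ x * Y x.1 + ∑ x, χ x * Y x.2.1 + ∑ x, χ x * Y x.2.2) := by
        rw [← Finset.sum_add_distrib, ← Finset.sum_add_distrib, Finset.mul_sum]
        exact Finset.sum_congr rfl fun x _ => by ring
    _ = 81 * B ^ 2 * ρ ^ 2 * ∑ x, χ x * Y x.1 := by rw [hthd, hsnd]; ring
    _ ≤ 81 * B ^ 2 * ρ ^ 2 * (G * ∑ j, Y j) := mul_le_mul_of_nonneg_left hfst (by positivity)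
    _ = _ := by ring

lemma sum_weight_mul_abs_curvatureEntry_le (hχ : ∀ x, 0 ≤ χ x)
    (h₁ : ∀ j k l, χ (j, k, l) = χ (k, j, l)) (h₂ : ∀ j k l, χ (j, k, l) = χ (j, l, k))
    {h G : ℝ} (hUh : ∀ l i, |U l i| ≤ |u l i| + h)
    (hG : ∀ i j, ∑ x, χ x * (if x.1 = j then |u x.2.2 i| + h else 0) ≤ G) :
    ∑ x, χ x * |curvatureEntry U V x| ≤ 3 * G * ∑ j, ∑ i, V j i ^ 2 := by
  set F : Fin d × Fin d × Fin d → ℝ := fun x => ∑ i, |V x.1 i| * |V x.2.1 i| * |U x.2.2 i| with hF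
  have hbase : ∑ x, χ x * F x ≤ G * ∑ j, ∑ i, V j i ^ 2 := by
    set Z : Fin r → Fin d × Fin d × Fin d → ℝ := fun i x => V x.1 i ^ 2 * (|u x.2.2 i| + h) with hZ
    have hZle : ∀ i, ∑ x, χ x * Z i x ≤ G * ∑ j, V j i ^ 2 := fun i =>
      sum_weight_mul_fst_le (f := fun j => V j i ^ 2) (fun j => sq_nonneg _)
        (w := fun l => |u l i| + h) (hG i)
    have hswap : ∀ i, ∑ x, χ x * Z i (x.2.1, x.1, x.2.2) = ∑ x, χ x * Z i x := fun i =>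
      (sum_symm_swap_left h₁ (Z i)).symm
    calc ∑ x, χ x * F x
        ≤ ∑ x, χ x * ∑ i, (Z i x + Z i (x.2.1, x.1, x.2.2)) / 2 := by
          refine Finset.sum_le_sum fun x _ => mul_le_mul_of_nonneg_left
            (Finset.sum_le_sum fun i _ => ?_) (hχ x)
          have k1 : |V x.1 i| * |V x.2.1 i| ≤ (V x.1 i ^ 2 + V x.2.1 i ^ 2) / 2 := by
            nlinarith [sq_nonneg (|V x.1 i| - |V x.2.1 i|), sq_abs (V x.1 i), sq_abs (V x.2.1 i)]
          refine (mul_le_mul k1 (hUh x.2.2 i) (abs_nonneg _) (by positivity)).trans (le_of_eq ?_)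
          simp only [hZ]
          ring
      _ = ∑ i, (∑ x, χ x * Z i x + ∑ x, χ x * Z i (x.2.1, x.1, x.2.2)) / 2 := by
          simp only [Finset.mul_sum]
          rw [Finset.sum_comm]
          refine Finset.sum_congr rfl fun i _ => ?_
          rw [← Finset.sum_add_distrib, Finset.sum_div]
          exact Finset.sum_congr rfl fun x _ => by ring
      _ = ∑ i, ∑ x, χ x * Z i x := Finset.sum_congr rfl fun i _ => by rw [hswap]; ring
      _ ≤ ∑ i, G * ∑ j, V j i ^ 2 := Finset.sum_le_sum fun i _ => hZle i
      _ = G * ∑ j, ∑ i, V j i ^ 2 := by rw [← Finset.mul_sum, Finset.sum_comm]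
  have e2 : ∑ x, χ x * F (x.1, x.2.2, x.2.1) = ∑ x, χ x * F x := (sum_symm_swap_right h₂ F).symm
  have e3 : ∑ x, χ x * F (x.2.1, x.2.2, x.1) = ∑ x, χ x * F x := by
    rw [← e2]
    exact (sum_symm_swap_left h₁ fun x => F (x.1, x.2.2, x.2.1)).symm
  have hle : ∀ x, |curvatureEntry U V x| ≤ F x + F (x.1, x.2.2, x.2.1) + F (x.2.1, x.2.2, x.1) := by
    intro x
    simp only [curvatureEntry, hF, ← Finset.sum_add_distrib]
    refine (Finset.abs_sum_le_sum_abs _ _).trans (Finset.sum_le_sum fun i _ => ?_)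
    refine (abs_add_three _ _ _).trans (le_of_eq ?_)
    simp only [abs_mul]
    ring
  calc _ ≤ ∑ x, χ x * (F x + F (x.1, x.2.2, x.2.1) + F (x.2.1, x.2.2, x.1)) :=
        Finset.sum_le_sum fun x _ => mul_le_mul_of_nonneg_left (hle x) (hχ x)
    _ = 3 * ∑ x, χ x * F x := by
        simp only [mul_add, Finset.sum_add_distrib]
        rw [e2, e3]
        ring
    _ ≤ 3 * (G * ∑ j, ∑ i, V j i ^ 2) := mul_le_mul_of_nonneg_left hbase (by norm_num)
    _ = _ := by ring

end SymmetricWeights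

end Deterministic

/-! ### From concentration to Hessian bounds -/

section HessianBounds

variable {d r : ℕ}

open Classical in
/-- The deterministic part of the argument: the bounds on the Hessian follow from the degree bounds
`hdeg` for the sampled set and from the concentration `hquad` on the tangent space at `u`. -/
lemma hessianForm_bounds {p σ m g h B ρ β : ℝ} {S : Set (Fin d × Fin d × Fin d)}
    {u U V : Matrix (Fin d) (Fin r) ℝ} (hr : 0 < r) (hp : 0 < p)
    (hS₁ : ∀ j k l, (j, k, l) ∈ S ↔ (k, j, l) ∈ S) (hS₂ : ∀ j k l, (j, k, l) ∈ S ↔ (j, l, k) ∈ S)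
    (hβ0 : 0 < β) (hβ1 : β ≤ 1) (hβ : β * σ ^ 4 ≤ m ^ 4)
    (hg0 : 0 ≤ g) (hg1 : g ≤ 1) (hgr : g * r ≤ β / 100)
    (hσ : ∀ i, ∑ j, u j i ^ 2 ≤ σ ^ 2) (hm : ∀ i, m ^ 2 ≤ ∑ j, u j i ^ 2)
    (hcoh : ∀ i i', i ≠ i' → |∑ j, u j i * u j i'| ≤ g * σ ^ 2) (hu : ∀ j i, |u j i| ≤ B)
    (hρ : 0 ≤ ρ) (hρB : ρ ≤ B) (hρh : ρ ≤ h) (hh : 0 < h)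
    (hU : ∀ j, ∑ i, (U j i - u j i) ^ 2 ≤ ρ ^ 2)
    (hsmall₁ : B ^ 2 * ρ ^ 2 * (d : ℝ) ^ 2 ≤ (β / 10000) ^ 2 * σ ^ 4)
    (hsmall₂ : B ^ 2 * ρ * √r * h * (d : ℝ) ^ 2 ≤ β / 10000 * σ ^ 4)
    (hdeg : ∀ i j, ∑ x, (if x ∈ S then (if x.1 = j then |u x.2.2 i| + h else 0) else 0)
      ≤ 7 * p * (d : ℝ) ^ 2 * h)
    (hquad : p * (9 / 10) * ∑ x, tangentEntry u V x ^ 2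
          - p * (β / 100) * σ ^ 4 * ∑ j, ∑ i, V j i ^ 2
          ≤ ∑ x, (if x ∈ S then tangentEntry u V x ^ 2 else 0) ∧
        ∑ x, (if x ∈ S then tangentEntry u V x ^ 2 else 0)
          ≤ p * (10 / 9) * ∑ x, tangentEntry u V x ^ 2
            + p * (β / 100) * σ ^ 4 * ∑ j, ∑ i, V j i ^ 2) :
    1 / 2 * m ^ 4 * ∑ j, ∑ i, V j i ^ 2 ≤ hessianForm (fClean p S u) U V ∧
      hessianForm (fClean p S u) U V ≤ 4 * σ ^ 4 * ∑ j, ∑ i, V j i ^ 2 := by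
  set χ : Fin d × Fin d × Fin d → ℝ := fun x => if x ∈ S then 1 else 0 with hχ
  have hχ0 : ∀ x, 0 ≤ χ x := fun x => by rw [hχ]; positivity
  have hχ' : ∀ (x : Fin d × Fin d × Fin d) (y : ℝ), (if x ∈ S then y else 0) = χ x * y := by
    intro x y
    simp [hχ]
  have h₁ : ∀ j k l, χ (j, k, l) = χ (k, j, l) := fun j k l => if_congr (hS₁ j k l) rfl rfl
  have h₂ : ∀ j k l, χ (j, k, l) = χ (j, l, k) := fun j k l => if_congr (hS₂ j k l) rfl rfl
  rw [hessianForm_fClean]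
  simp only [hχ'] at hdeg hquad ⊢
  set N := ∑ j, ∑ i, V j i ^ 2 with hN
  have hN0 : 0 ≤ N := Finset.sum_nonneg fun i _ => Finset.sum_nonneg fun j _ => sq_nonneg _
  have hσN : 0 ≤ σ ^ 4 * N := by positivity
  have hB : 0 ≤ B := hρ.trans hρB
  -- the unweighted degrees are controlled by the weighted ones
  have hcard : ∀ j, ∑ x, χ x * (if x.1 = j then 1 else 0) ≤ 7 * p * (d : ℝ) ^ 2 := by
    intro j
    refine le_of_mul_le_mul_right ((?_ : _ ≤ _).trans (hdeg ⟨0, hr⟩ j)) hh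
    rw [Finset.sum_mul]
    refine Finset.sum_le_sum fun x _ => ?_
    rw [mul_assoc]
    refine mul_le_mul_of_nonneg_left ?_ (hχ0 x)
    split_ifs
    · linarith [abs_nonneg (u x.2.2 ⟨0, hr⟩)]
    · simp
  have hpert : ∑ x, χ x * (tangentEntry U V x - tangentEntry u V x) ^ 2
      ≤ p * (567 * (β / 10000) ^ 2) * (σ ^ 4 * N) := by
    refine (sum_weight_mul_sq_tangentEntry_sub_le hχ0 h₁ h₂ hρ hρB hu hU hcard).trans ?_
    calc _ = 567 * p * (B ^ 2 * ρ ^ 2 * (d : ℝ) ^ 2) * N := by rw [hN]; ring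
      _ ≤ 567 * p * ((β / 10000) ^ 2 * σ ^ 4) * N := by gcongr
      _ = _ := by ring
  have hUh : ∀ l i, |U l i| ≤ |u l i| + h := fun l i => by
    have h1 : |U l i - u l i| ≤ ρ := abs_le_of_sum_sq_le hρ (hU l) i
    have h2 := abs_add_le (u l i) (U l i - u l i)
    rw [add_sub_cancel] at h2
    linarith
  have hcurv : |∑ x, χ x * ((cpEntry U x - cpEntry u x) * curvatureEntry U V x)|
      ≤ p * (147 * (β / 10000)) * (σ ^ 4 * N) := by
    have hE := sum_weight_mul_abs_curvatureEntry_le (V := V) hχ0 h₁ h₂ hUh hdeg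
    calc _ ≤ ∑ x, 7 * B ^ 2 * ρ * √r * (χ x * |curvatureEntry U V x|) := by
          refine (Finset.abs_sum_le_sum_abs _ _).trans (Finset.sum_le_sum fun x _ => ?_)
          rw [abs_mul, abs_mul, abs_of_nonneg (hχ0 x)]
          have := mul_le_mul_of_nonneg_right (abs_cpEntry_sub_le hρ hρB hu hU x)
            (mul_nonneg (hχ0 x) (abs_nonneg (curvatureEntry U V x)))
          linarith
      _ ≤ 7 * B ^ 2 * ρ * √r * (3 * (7 * p * (d : ℝ) ^ 2 * h) * N) := by
          rw [← Finset.mul_sum]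
          exact mul_le_mul_of_nonneg_left hE (by positivity)
      _ = 147 * p * (B ^ 2 * ρ * √r * h * (d : ℝ) ^ 2) * N := by ring
      _ ≤ 147 * p * (β / 10000 * σ ^ 4) * N := by gcongr
      _ = _ := by ring
  have hpop := sum_tangentEntry_sq_bounds hg0 hg1 hgr hσ hm hcoh V
  rw [← hN] at hpop
  -- `(a + b)² ≥ (9/10) a² - 10 b²` and `(a + b)² ≤ (11/10) a² + 11 b²`
  have hlow : 9 / 10 * ∑ x, χ x * tangentEntry u V x ^ 2
      - 10 * ∑ x, χ x * (tangentEntry U V x - tangentEntry u V x) ^ 2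
      ≤ ∑ x, χ x * tangentEntry U V x ^ 2 := by
    rw [Finset.mul_sum, Finset.mul_sum, ← Finset.sum_sub_distrib]
    refine Finset.sum_le_sum fun x _ => ?_
    have := mul_le_mul_of_nonneg_left (by
      nlinarith [sq_nonneg (10 * tangentEntry U V x - 9 * tangentEntry u V x)] :
      9 / 10 * tangentEntry u V x ^ 2 - 10 * (tangentEntry U V x - tangentEntry u V x) ^ 2
        ≤ tangentEntry U V x ^ 2) (hχ0 x)
    linarith
  have hupp : ∑ x, χ x * tangentEntry U V x ^ 2 ≤ 11 / 10 * ∑ x, χ x * tangentEntry u V x ^ 2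
      + 11 * ∑ x, χ x * (tangentEntry U V x - tangentEntry u V x) ^ 2 := by
    rw [Finset.mul_sum, Finset.mul_sum, ← Finset.sum_add_distrib]
    refine Finset.sum_le_sum fun x _ => ?_
    have := mul_le_mul_of_nonneg_left (by
      nlinarith [sq_nonneg (10 * tangentEntry U V x - 11 * tangentEntry u V x)] :
      tangentEntry U V x ^ 2 ≤ 11 / 10 * tangentEntry u V x ^ 2
        + 11 * (tangentEntry U V x - tangentEntry u V x) ^ 2) (hχ0 x)
    linarith
  generalize ∑ x, χ x * tangentEntry U V x ^ 2 = QU at *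
  generalize ∑ x, χ x * tangentEntry u V x ^ 2 = Qu at *
  generalize ∑ x, χ x * (tangentEntry U V x - tangentEntry u V x) ^ 2 = Qd at *
  generalize ∑ x, χ x * ((cpEntry U x - cpEntry u x) * curvatureEntry U V x) = L at *
  generalize ∑ x, tangentEntry u V x ^ 2 = T at *
  obtain ⟨hL1, hL2⟩ := abs_le.1 hcurv
  obtain ⟨hq1, hq2⟩ := hquad
  obtain ⟨hT1, hT2⟩ := hpop
  have hβN : β * (σ ^ 4 * N) ≤ m ^ 4 * N := by
    have := mul_le_mul_of_nonneg_right hβ hN0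
    linarith
  have hββ : β ^ 2 * (σ ^ 4 * N) ≤ β * (σ ^ 4 * N) := by
    refine mul_le_mul_of_nonneg_right ?_ hσN
    nlinarith
  have hβσ : β * (σ ^ 4 * N) ≤ σ ^ 4 * N := mul_le_of_le_one_left hσN hβ1
  have hpT1 := mul_le_mul_of_nonneg_left hT1 hp.le
  have hpT2 := mul_le_mul_of_nonneg_left hT2 hp.le
  have hpβ := mul_le_mul_of_nonneg_left hβN hp.le
  have hpββ := mul_le_mul_of_nonneg_left hββ hp.le
  have hpβσ := mul_le_mul_of_nonneg_left hβσ hp.le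
  have hpσ : 0 ≤ p * (σ ^ 4 * N) := by positivity
  have hpm : 0 ≤ p * (m ^ 4 * N) := by positivity
  have e : 1 / (3 * p) * QU + 2 / (3 * p) * L = (QU + 2 * L) / (3 * p) := by
    field_simp
  rw [e, le_div_iff₀ (by positivity), div_le_iff₀ (by positivity)]
  constructor
  · linarith
  · linarith

end HessianBounds

/-! ### High-probability events -/

section SamplingEvents

open Matrix

variable {d r : ℕ} {Ω : Type*} [MeasurableSpace Ω] {P : Measure Ω} [IsProbabilityMeasure P]
  {p : ℝ} {S : Ω → Set (Fin d × Fin d × Fin d)}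

open Classical in
/-- With high probability the sampled triples with a given first index are not too many, weighted by
`|w l| + h` for a vector `w` of norm at most `σ = h √d`. -/
lemma IsSymmetricSampling.measureReal_degree (hS : IsSymmetricSampling P p S) (hp0 : 0 ≤ p)
    (hp1 : p ≤ 1) {w : Fin d → ℝ} {h B s : ℝ} (hh : 0 < h) (hhB : h ≤ B) (hw : ∀ l, |w l| ≤ B)
    (hwσ : ∑ l, w l ^ 2 ≤ h ^ 2 * d) (hs : 12 * B * s ≤ p * (d : ℝ) ^ 2 * h) (j : Fin d) :
    P.real {ω | ¬ ∑ x, (if x ∈ S ω then (if x.1 = j then |w x.2.2| + h else 0) else 0)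
      ≤ 7 * p * (d : ℝ) ^ 2 * h} ≤ Real.exp (-s) := by
  refine (measureReal_mono ?_).trans (hS.measureReal_sum_weight hp0 hp1
    (w := fun x => if x.1 = j then |w x.2.2| + h else 0) (b := 2 * B) (fun x => ?_) (fun x => ?_)
    (by linarith) s)
  · intro ω hω hle
    refine hω (hle.trans ?_)
    have hsum : ∑ x : Fin d × Fin d × Fin d, (if x.1 = j then |w x.2.2| + h else 0)
        = d * ∑ l, |w l| + (d : ℝ) ^ 2 * h := by
      simp only [Fintype.sum_prod_type]
      rw [Finset.sum_eq_single j (fun b _ hb => by simp [hb]) (by simp)]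
      simp only [if_true, Finset.sum_const, Finset.card_univ, Fintype.card_fin, nsmul_eq_mul,
        Finset.sum_add_distrib]
      ring
    have hl1 : ∑ l, |w l| ≤ d * h := by
      refine abs_le_of_sq_le_sq' (?_ : _ ≤ (d * h) ^ 2) (by positivity) |>.2
      have := sq_sum_le_card_mul_sum_sq (s := Finset.univ) (f := fun l => |w l|)
      simp only [sq_abs, Finset.card_univ, Fintype.card_fin] at this
      have h2 := mul_le_mul_of_nonneg_left hwσ (Nat.cast_nonneg (α := ℝ) d)
      linarith [this, h2, (by ring : (d : ℝ) * (h ^ 2 * d) = (d * h) ^ 2)]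
    have h3 : (d : ℝ) * ∑ l, |w l| ≤ (d : ℝ) * (d * h) :=
      mul_le_mul_of_nonneg_left hl1 (Nat.cast_nonneg d)
    rw [hsum]
    nlinarith
  · split_ifs
    · positivity
    · exact le_rfl
  · split_ifs
    · linarith [hw x.2.2]
    · linarith

/-- The vector `a x` for which `⟨a x, V⟩` is the entry at `x` of the tangent vector of `V`. -/
def tangentVec (u : Matrix (Fin d) (Fin r) ℝ) (x : Fin d × Fin d × Fin d) : Fin d × Fin r → ℝ :=
  fun y => (if y.1 = x.1 then u x.2.1 y.2 * u x.2.2 y.2 else 0)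
    + (if y.1 = x.2.1 then u x.1 y.2 * u x.2.2 y.2 else 0)
    + (if y.1 = x.2.2 then u x.1 y.2 * u x.2.1 y.2 else 0)

lemma tangentVec_dotProduct (u V : Matrix (Fin d) (Fin r) ℝ) (x : Fin d × Fin d × Fin d) :
    tangentVec u x ⬝ᵥ (fun y => V y.1 y.2) = tangentEntry u V x := by
  simp only [dotProduct, tangentVec, Fintype.sum_prod_type_right, tangentEntry, add_mul, ite_mul,
    zero_mul, Finset.sum_add_distrib, Finset.sum_ite_eq', Finset.mem_univ, if_true]
  congr 1
  · congr 1
    · exact Finset.sum_congr rfl fun i _ => by ring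
    · exact Finset.sum_congr rfl fun i _ => by ring

lemma tangentVec_dotProduct_self_le {u : Matrix (Fin d) (Fin r) ℝ} {B : ℝ}
    (hu : ∀ j i, |u j i| ≤ B) (x : Fin d × Fin d × Fin d) :
    tangentVec u x ⬝ᵥ tangentVec u x ≤ 9 * r * B ^ 4 := by
  have hmul : ∀ j k i, (u j i * u k i) ^ 2 ≤ B ^ 4 := fun j k i => by
    have h1 : u j i ^ 2 ≤ B ^ 2 := sq_le_sq' (abs_le.1 (hu j i)).1 (abs_le.1 (hu j i)).2
    have h2 : u k i ^ 2 ≤ B ^ 2 := sq_le_sq' (abs_le.1 (hu k i)).1 (abs_le.1 (hu k i)).2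
    calc (u j i * u k i) ^ 2 = u j i ^ 2 * u k i ^ 2 := mul_pow _ _ _
      _ ≤ B ^ 2 * B ^ 2 := mul_le_mul h1 h2 (sq_nonneg _) (sq_nonneg _)
      _ = B ^ 4 := by ring
  calc tangentVec u x ⬝ᵥ tangentVec u x
      ≤ ∑ y : Fin d × Fin r, 3 * ((if y.1 = x.1 then B ^ 4 else 0)
          + (if y.1 = x.2.1 then B ^ 4 else 0) + (if y.1 = x.2.2 then B ^ 4 else 0)) := by
        refine Finset.sum_le_sum fun y _ => ?_
        have hsq : ∀ (c : Prop) [Decidable c] (a : ℝ), a ^ 2 ≤ B ^ 4 →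
            (if c then a else 0) ^ 2 ≤ if c then B ^ 4 else 0 := fun c _ a ha => by
          split_ifs
          · exact ha
          · simp
        have h1 := hsq (y.1 = x.1) _ (hmul x.2.1 x.2.2 y.2)
        have h2 := hsq (y.1 = x.2.1) _ (hmul x.1 x.2.2 y.2)
        have h3 := hsq (y.1 = x.2.2) _ (hmul x.1 x.2.1 y.2)
        simp only [tangentVec]
        generalize (if y.1 = x.1 then u x.2.1 y.2 * u x.2.2 y.2 else 0) = α at *
        generalize (if y.1 = x.2.1 then u x.1 y.2 * u x.2.2 y.2 else 0) = γ at *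
        generalize (if y.1 = x.2.2 then u x.1 y.2 * u x.2.1 y.2 else 0) = η at *
        nlinarith [sq_nonneg (α - γ), sq_nonneg (γ - η), sq_nonneg (α - η)]
    _ = 9 * r * B ^ 4 := by
        rw [← Finset.mul_sum]
        simp only [Fintype.sum_prod_type_right, Finset.sum_add_distrib, Finset.sum_ite_eq',
          Finset.mem_univ, if_true, Finset.sum_const, Finset.card_univ, Fintype.card_fin,
          nsmul_eq_mul]
        ring

open Classical in
/-- With high probability the sampled Frobenius norm is proportional to the full one on the tangent
space at `u`, up to a small multiple of `‖V‖²`. -/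
lemma IsSymmetricSampling.measureReal_tangent (hS : IsSymmetricSampling P p S) (hp0 : 0 ≤ p)
    (hp1 : p ≤ 1) {u : Matrix (Fin d) (Fin r) ℝ} {B s ν : ℝ} (hr : 0 < r) (hB : 0 < B)
    (hu : ∀ j i, |u j i| ≤ B) (hs : 540 * r * B ^ 4 * s ≤ p * ν) :
    P.real {ω | ¬ ∀ V : Matrix (Fin d) (Fin r) ℝ,
        p * (9 / 10) * ∑ x, tangentEntry u V x ^ 2 - p * ν * ∑ j, ∑ i, V j i ^ 2
          ≤ ∑ x, (if x ∈ S ω then tangentEntry u V x ^ 2 else 0) ∧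
        ∑ x, (if x ∈ S ω then tangentEntry u V x ^ 2 else 0)
          ≤ p * (10 / 9) * ∑ x, tangentEntry u V x ^ 2 + p * ν * ∑ j, ∑ i, V j i ^ 2}
      ≤ 2 * (d * r * Real.exp (-s)) := by
  have hR : 0 < 9 * r * B ^ 4 := by positivity
  have key := hS.measureReal_quadForm hp0 hp1 (a := tangentVec u) (R := 9 * r * B ^ 4)
    -- this choice makes the relative error `exp (± 1 / 10)`
    (θ := 1 / (60 * (9 * r * B ^ 4)))
    (fun j k l => by ext y; simp only [tangentVec]; ring_nf)
    (fun j k l => by ext y; simp only [tangentVec]; ring_nf)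
    (tangentVec_dotProduct_self_le hu) (by positivity) s
  simp only [Fintype.card_prod, Fintype.card_fin, Nat.cast_mul] at key
  refine (measureReal_mono ?_).trans key
  intro ω hω hcon
  refine hω fun V => ?_
  have hV := hcon fun y => V y.1 y.2
  simp only [tangentVec_dotProduct] at hV
  have e1 : 1 / (60 * (9 * r * B ^ 4)) * (6 * (9 * r * B ^ 4)) = 1 / 10 := by
    field_simp; norm_num
  have e2 : s / (1 / (60 * (9 * r * B ^ 4))) = 540 * r * B ^ 4 * s := by
    field_simp; ring
  have e3 : (fun y : Fin d × Fin r => V y.1 y.2) ⬝ᵥ (fun y => V y.1 y.2)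
      = ∑ j, ∑ i, V j i ^ 2 := by
    simp only [dotProduct, Fintype.sum_prod_type, sq]
  rw [e1, e2, e3] at hV
  have h1 : (9 / 10 : ℝ) ≤ Real.exp (-(1 / 10)) := by
    have := Real.add_one_le_exp (-(1 / 10) : ℝ)
    linarith
  have h2 : Real.exp (1 / 10) ≤ 10 / 9 := by
    have h3 := inv_anti₀ (by norm_num) h1
    rw [Real.exp_neg, inv_inv] at h3
    linarith
  have hT : 0 ≤ p * ∑ x, tangentEntry u V x ^ 2 :=
    mul_nonneg hp0 (Finset.sum_nonneg fun x _ => sq_nonneg _)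
  have hN : 0 ≤ ∑ j, ∑ i, V j i ^ 2 :=
    Finset.sum_nonneg fun i _ => Finset.sum_nonneg fun j _ => sq_nonneg _
  have h4 := mul_le_mul_of_nonneg_right h1 hT
  have h5 := mul_le_mul_of_nonneg_right h2 hT
  have h6 := mul_le_mul_of_nonneg_right hs hN
  constructor
  · linarith [hV.1]
  · linarith [hV.2]

end SamplingEvents

/-! ### Consequences of incoherence -/

section Incoherence

open Matrix

variable {d r : ℕ} {u : Matrix (Fin d) (Fin r) ℝ}

lemma euclNorm_nonneg {n : ℕ} (x : Fin n → ℝ) : 0 ≤ euclNorm x := Real.sqrt_nonneg _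

lemma euclNorm_sq {n : ℕ} (x : Fin n → ℝ) : euclNorm x ^ 2 = ∑ j, x j ^ 2 :=
  Real.sq_sqrt (Finset.sum_nonneg fun _ _ => sq_nonneg _)

lemma euclNorm_pos {n : ℕ} {x : Fin n → ℝ} (hx : x ≠ 0) : 0 < euclNorm x := by
  obtain ⟨j, hj⟩ := Function.ne_iff.1 hx
  exact Real.sqrt_pos.2 (Finset.sum_pos' (fun _ _ => sq_nonneg _)
    ⟨j, Finset.mem_univ j, sq_pos_iff.2 hj⟩)

lemma frobenius_norm_sq (V : Matrix (Fin d) (Fin r) ℝ) : ‖V‖ ^ 2 = ∑ j, ∑ i, V j i ^ 2 := by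
  rw [Matrix.frobenius_norm_def, ← Real.sqrt_eq_rpow, Real.sq_sqrt (by positivity)]
  simp

lemma mul_norm_col_sq_le (hu : ∀ i, u.col i ≠ 0) (i : Fin r) :
    (d : ℝ) * ‖u.col i‖ ^ 2 ≤ incoherence u * euclNorm (u.col i) ^ 2 := by
  have h1 : (d : ℝ) * ‖u.col i‖ ^ 2 / euclNorm (u.col i) ^ 2 ≤ incoherence u :=
    (le_ciSup (f := fun i => (d : ℝ) * ‖u.col i‖ ^ 2 / euclNorm (u.col i) ^ 2)
      (Set.finite_range _).bddAbove i).trans ((le_max_left _ _).trans (le_max_right _ _))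
  rwa [div_le_iff₀ (pow_pos (euclNorm_pos (hu i)) 2)] at h1

lemma mul_entry_sq_le (hu : ∀ i, u.col i ≠ 0) (j : Fin d) (i : Fin r) :
    (d : ℝ) * u j i ^ 2 ≤ incoherence u * euclNorm (u.col i) ^ 2 := by
  refine le_trans ?_ (mul_norm_col_sq_le hu i)
  refine mul_le_mul_of_nonneg_left ?_ (Nat.cast_nonneg d)
  rw [← sq_abs]
  exact pow_le_pow_left₀ (abs_nonneg _) (norm_le_pi_norm (u.col i) j) 2

lemma mul_dotProduct_sq_le (hu : ∀ i, u.col i ≠ 0) {i i' : Fin r} (h : i ≠ i') :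
    (d : ℝ) * (∑ j, u j i * u j i') ^ 2
      ≤ incoherence u * (euclNorm (u.col i) ^ 2 * euclNorm (u.col i') ^ 2) := by
  have h1 : (d : ℝ) * (u.col i ⬝ᵥ u.col i') ^ 2
      / (euclNorm (u.col i) ^ 2 * euclNorm (u.col i') ^ 2) ≤ incoherence u := by
    refine le_trans ?_ ((le_max_right _ _).trans (le_max_right _ _))
    refine le_trans ?_ (le_ciSup (f := fun i => ⨆ j, if i = j then 0 else
      (d : ℝ) * (u.col i ⬝ᵥ u.col j) ^ 2 / (euclNorm (u.col i) ^ 2 * euclNorm (u.col j) ^ 2))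
      (Set.finite_range _).bddAbove i)
    refine le_trans (le_of_eq ?_) (le_ciSup (f := fun j => if i = j then 0 else
      (d : ℝ) * (u.col i ⬝ᵥ u.col j) ^ 2 / (euclNorm (u.col i) ^ 2 * euclNorm (u.col j) ^ 2))
      (Set.finite_range _).bddAbove i')
    rw [if_neg h]
  rwa [div_le_iff₀ (mul_pos (pow_pos (euclNorm_pos (hu i)) 2)
    (pow_pos (euclNorm_pos (hu i')) 2))] at h1

lemma one_le_incoherence (hr : 0 < r) (hu : ∀ i, u.col i ≠ 0) : 1 ≤ incoherence u := by
  set i : Fin r := ⟨0, hr⟩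
  have hpos := pow_pos (euclNorm_pos (hu i)) 2
  refine le_of_mul_le_mul_right ?_ hpos
  rw [one_mul]
  refine le_trans ?_ (mul_norm_col_sq_le hu i)
  rw [euclNorm_sq]
  have h := Finset.sum_le_card_nsmul Finset.univ (fun j => u.col i j ^ 2) (‖u.col i‖ ^ 2)
    fun j _ => by
      rw [← sq_abs]
      exact pow_le_pow_left₀ (abs_nonneg _) (norm_le_pi_norm (u.col i) j) 2
  simpa using h

/-- The extreme column norms, in terms of which the condition number, `λ_min` and `λ_max` are
expressed. -/
lemma exists_extreme_euclNorm (hr : 0 < r) (hu : ∀ i, u.col i ≠ 0) :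
    ∃ m σ : ℝ, 0 < m ∧ 0 < σ ∧ (∀ i, m ≤ euclNorm (u.col i)) ∧ (∀ i, euclNorm (u.col i) ≤ σ) ∧
      condNumber u = σ / m ∧ lambdaMin u ^ (4 / 3 : ℝ) = m ^ 4 ∧
      lambdaMax u ^ (4 / 3 : ℝ) = σ ^ 4 := by
  have : Nonempty (Fin r) := ⟨⟨0, hr⟩⟩
  obtain ⟨i₀, hi₀⟩ := exists_eq_ciInf_of_finite (f := fun i => euclNorm (u.col i))
  obtain ⟨i₁, hi₁⟩ := exists_eq_ciSup_of_finite (f := fun i => euclNorm (u.col i))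
  have hm : ∀ i, euclNorm (u.col i₀) ≤ euclNorm (u.col i) := fun i =>
    hi₀.le.trans (ciInf_le (Set.finite_range _).bddBelow i)
  have hσ : ∀ i, euclNorm (u.col i) ≤ euclNorm (u.col i₁) := fun i =>
    (le_ciSup (f := fun i => euclNorm (u.col i)) (Set.finite_range _).bddAbove i).trans hi₁.ge
  have hpow : ∀ x : ℝ, 0 ≤ x → (x ^ 3) ^ (4 / 3 : ℝ) = x ^ 4 := fun x hx => by
    rw [← Real.rpow_natCast, ← Real.rpow_natCast, ← Real.rpow_mul hx]
    norm_num
  refine ⟨euclNorm (u.col i₀), euclNorm (u.col i₁), euclNorm_pos (hu i₀), euclNorm_pos (hu i₁),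
    hm, hσ, ?_, ?_, ?_⟩
  · rw [condNumber, ← hi₀, ← hi₁]
  · rw [← hpow _ (euclNorm_nonneg _)]
    congr 1
    exact le_antisymm (ciInf_le (Set.finite_range _).bddBelow i₀)
      (le_ciInf fun i => pow_le_pow_left₀ (euclNorm_nonneg _) (hm i) 3)
  · rw [← hpow _ (euclNorm_nonneg _)]
    congr 1
    exact le_antisymm (ciSup_le fun i => pow_le_pow_left₀ (euclNorm_nonneg _) (hσ i) 3)
      (le_ciSup (f := fun i => euclNorm (u.col i) ^ 3) (Set.finite_range _).bddAbove i₁)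

lemma sum_row_sq_le_twoInftyNorm_sq (M : Matrix (Fin d) (Fin r) ℝ) (j : Fin d) :
    ∑ i, M j i ^ 2 ≤ twoInftyNorm M ^ 2 := by
  have h : euclNorm (M.row j) ≤ twoInftyNorm M :=
    le_ciSup (f := fun i => euclNorm (M.row i)) (Set.finite_range _).bddAbove j
  have h2 := pow_le_pow_left₀ (euclNorm_nonneg _) h 2
  rwa [euclNorm_sq] at h2

lemma twoInftyNorm_le {B : ℝ} (hd : 0 < d) (hB : 0 ≤ B) (hu : ∀ j i, |u j i| ≤ B) :
    twoInftyNorm u ≤ √r * B := by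
  have : Nonempty (Fin d) := ⟨⟨0, hd⟩⟩
  refine ciSup_le fun j => ?_
  refine abs_le_of_sq_le_sq' (?_ : _ ≤ (√r * B) ^ 2) (by positivity) |>.2
  rw [euclNorm_sq, mul_pow, Real.sq_sqrt (Nat.cast_nonneg r)]
  have h := Finset.sum_le_card_nsmul Finset.univ (fun i => u.row j i ^ 2) (B ^ 2)
    fun i _ => sq_le_sq' (abs_le.1 (hu j i)).1 (abs_le.1 (hu j i)).2
  simpa using h

end Incoherence

/-! ### The parameter regime -/

section ParameterRegime

variable {d r : ℕ} {Ω : Type*} [MeasurableSpace Ω] {P : Measure Ω} [IsProbabilityMeasure P]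
  {p : ℝ} {S : Ω → Set (Fin d × Fin d × Fin d)}

open Classical in
/-- The sampling events used by the deterministic bounds hold together with probability at least
`1 - 3 / d ^ 10`. -/
lemma IsSymmetricSampling.one_sub_le_measureReal (hS : IsSymmetricSampling P p S) (hp0 : 0 ≤ p)
    (hd : 0 < d) (hr : 0 < r) (hrd : r ≤ d) {u : Matrix (Fin d) (Fin r) ℝ} {h B ν : ℝ}
    (hh : 0 < h) (hhB : h ≤ B) (hu : ∀ j i, |u j i| ≤ B)
    (hcol : ∀ i, ∑ l, u l i ^ 2 ≤ h ^ 2 * d)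
    (hs₁ : 12 * (12 * B * Real.log d) ≤ p * (d : ℝ) ^ 2 * h)
    (hs₂ : 6480 * r * B ^ 4 * Real.log d ≤ p * ν) {good : Set Ω}
    (hgood : ∀ ω, (∀ i j, ∑ x, (if x ∈ S ω then (if x.1 = j then |u x.2.2 i| + h else 0) else 0)
        ≤ 7 * p * (d : ℝ) ^ 2 * h) →
      (∀ V : Matrix (Fin d) (Fin r) ℝ,
        p * (9 / 10) * ∑ x, tangentEntry u V x ^ 2 - p * ν * ∑ j, ∑ i, V j i ^ 2
          ≤ ∑ x, (if x ∈ S ω then tangentEntry u V x ^ 2 else 0) ∧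
        ∑ x, (if x ∈ S ω then tangentEntry u V x ^ 2 else 0)
          ≤ p * (10 / 9) * ∑ x, tangentEntry u V x ^ 2 + p * ν * ∑ j, ∑ i, V j i ^ 2) →
      ω ∈ good) :
    1 - 3 / (d : ℝ) ^ 10 ≤ P.real good := by
  have hp1 := hS.le_one hd
  have hd0 : (0 : ℝ) < d := by exact_mod_cast hd
  -- the failure probability is at most `3 d r exp (-s)`, where `d r ≤ d²` and `exp (-s) = d⁻¹²`
  set s := 12 * Real.log d with hs
  have hexp : Real.exp (-s) = 1 / (d : ℝ) ^ 12 := by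
    have : Real.exp s = (d : ℝ) ^ 12 := by
      have h12 := Real.exp_nat_mul (Real.log d) 12
      rw [Real.exp_log hd0] at h12
      exact_mod_cast h12
    rw [Real.exp_neg, this, one_div]
  have hdeg := fun (i : Fin r) (j : Fin d) => hS.measureReal_degree hp0 hp1 hh hhB
    (fun l => hu l i) (hcol i) (s := s) (by rw [hs]; linarith) j
  have htan := hS.measureReal_tangent hp0 hp1 (s := s) (ν := ν) hr (hh.trans_le hhB) hu
    (by rw [hs]; linarith)
  set A := {ω | ¬ ∀ V : Matrix (Fin d) (Fin r) ℝ,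
        p * (9 / 10) * ∑ x, tangentEntry u V x ^ 2 - p * ν * ∑ j, ∑ i, V j i ^ 2
          ≤ ∑ x, (if x ∈ S ω then tangentEntry u V x ^ 2 else 0) ∧
        ∑ x, (if x ∈ S ω then tangentEntry u V x ^ 2 else 0)
          ≤ p * (10 / 9) * ∑ x, tangentEntry u V x ^ 2 + p * ν * ∑ j, ∑ i, V j i ^ 2} with hA
  set D : Fin r × Fin d → Set Ω := fun y =>
    {ω | ¬ ∑ x, (if x ∈ S ω then (if x.1 = y.2 then |u x.2.2 y.1| + h else 0) else 0)
      ≤ 7 * p * (d : ℝ) ^ 2 * h} with hD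
  have hDsum : P.real (⋃ y, D y) ≤ d * r * Real.exp (-s) := by
    refine (measureReal_iUnion_fintype_le _).trans ((Finset.sum_le_card_nsmul _ _ _
      fun y _ => hdeg y.1 y.2).trans (le_of_eq ?_))
    simp only [Finset.card_univ, Fintype.card_prod, Fintype.card_fin, nsmul_eq_mul, Nat.cast_mul]
    ring
  have hcover : (Set.univ : Set Ω) ⊆ good ∪ (A ∪ ⋃ y, D y) := by
    intro ω _
    by_contra hcon
    simp only [Set.mem_union, not_or, Set.mem_iUnion, not_exists] at hcon
    obtain ⟨h1, h2, h3⟩ := hcon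
    exact h1 (hgood ω (fun i j => not_not.1 (h3 (i, j))) (not_not.1 h2))
  have htotal : (1 : ℝ) ≤ P.real good + (P.real A + P.real (⋃ y, D y)) := by
    have h1 := measureReal_mono (μ := P) hcover (measure_ne_top _ _)
    rw [probReal_univ] at h1
    exact h1.trans ((measureReal_union_le _ _).trans
      (add_le_add le_rfl (measureReal_union_le _ _)))
  have hfinal : 3 * ((d : ℝ) * r * Real.exp (-s)) ≤ 3 / (d : ℝ) ^ 10 := by
    have hrd' : (r : ℝ) ≤ d := by exact_mod_cast hrd
    have h2 : (d : ℝ) * r ≤ (d : ℝ) ^ 2 := by nlinarith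
    rw [hexp, mul_one_div, mul_div_assoc', div_le_div_iff₀ (by positivity) (by positivity)]
    have h3 := mul_le_mul_of_nonneg_right h2 (by positivity : (0 : ℝ) ≤ 3 * (d : ℝ) ^ 10)
    linarith [h3, (by ring : (d : ℝ) ^ 2 * (3 * (d : ℝ) ^ 10) = 3 * (d : ℝ) ^ 12)]
  linarith

/-- The lower bound on the sampling rate, in the two forms in which it is used. -/
lemma sampling_rate_bounds {q h β p L r d : ℝ} (hq1 : 1 ≤ q) (hh : 0 < h) (hβ1 : β ≤ 1)
    (hp : 0 < p) (hL : 0 ≤ L) (hr1 : 1 ≤ r)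
    (hpL : 1000000 * (q ^ 4 * r ^ 2 * L) ≤ β * (p * d ^ 2)) :
    12 * (12 * (q * h) * L) ≤ p * d ^ 2 * h ∧
      6480 * r * (q * h) ^ 4 * L ≤ p * (β / 100 * (h ^ 2 * d) ^ 2) := by
  have hq0 : 0 < q := by linarith
  have hr0 : 0 < r := by linarith
  constructor
  · have h1 : q * L ≤ q ^ 4 * r ^ 2 * L := by
      refine mul_le_mul_of_nonneg_right ?_ hL
      have h2 : q ≤ q ^ 4 := le_self_pow₀ hq1 (by norm_num)
      exact h2.trans (le_mul_of_one_le_right (by positivity) (one_le_pow₀ hr1))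
    have h4 : β * (p * d ^ 2) ≤ p * d ^ 2 := mul_le_of_le_one_left (by positivity) hβ1
    have h5 : 144 * (q * L) ≤ p * d ^ 2 := by
      have : 0 ≤ q * L := by positivity
      linarith
    have h6 := mul_le_mul_of_nonneg_right h5 hh.le
    linarith
  · have h1 : q ^ 4 * r * L ≤ q ^ 4 * r ^ 2 * L := by
      have : r ≤ r ^ 2 := le_self_pow₀ hr1 (by norm_num)
      gcongr
    have h2 : 648000 * (q ^ 4 * r * L) ≤ β * (p * d ^ 2) := by
      have : 0 ≤ q ^ 4 * r * L := by positivity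
      linarith
    have h3 := mul_le_mul_of_nonneg_right h2 (by positivity : 0 ≤ h ^ 4)
    linarith

/-- Consequences of the bound on `δ` for the largest row norm `ρ` of `U - U⋆`. -/
lemma radius_bounds {q h β δ ρ r d : ℝ} (hq1 : 1 ≤ q) (hh : 0 < h) (hβ1 : β ≤ 1) (hr1 : 1 ≤ r)
    (hd : 0 < d) (hδ0 : 0 ≤ δ) (hδ : δ * (q ^ 3 * r) ≤ β / 10000) (hρ0 : 0 ≤ ρ)
    (hρ : ρ ≤ δ * (√r * (q * h))) :
    ρ ≤ h ∧ (q * h) ^ 2 * ρ ^ 2 * d ^ 2 ≤ (β / 10000) ^ 2 * (h ^ 2 * d) ^ 2 ∧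
      (q * h) ^ 2 * ρ * √r * h * d ^ 2 ≤ β / 10000 * (h ^ 2 * d) ^ 2 := by
  have hq0 : 0 < q := by linarith
  have hsr2 : √r ^ 2 = r := Real.sq_sqrt (by linarith)
  have hsr1 : 1 ≤ √r := Real.one_le_sqrt.2 hr1
  have hsr : √r ≤ r := by
    rw [← hsr2, Real.sqrt_sq (by linarith)]
    exact le_self_pow₀ hsr1 (by norm_num)
  have hq13 : q ≤ q ^ 3 := le_self_pow₀ hq1 (by norm_num)
  have hq23 : q ^ 2 ≤ q ^ 3 := pow_le_pow_right₀ hq1 (by norm_num)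
  refine ⟨?_, ?_, ?_⟩
  · have h2 : √r * q ≤ q ^ 3 * r := by
      rw [mul_comm]
      gcongr
    have h1 : δ * (√r * q) ≤ 1 := (mul_le_mul_of_nonneg_left h2 hδ0).trans (by linarith)
    have := mul_le_mul_of_nonneg_right h1 hh.le
    linarith
  · have h1 : q * h * ρ * d ≤ β / 10000 * (h ^ 2 * d) := by
      have h3 : δ * (q ^ 2 * √r) ≤ β / 10000 := by
        refine le_trans (mul_le_mul_of_nonneg_left ?_ hδ0) hδ
        gcongr
      calc q * h * ρ * d ≤ q * h * (δ * (√r * (q * h))) * d := by gcongr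
        _ = δ * (q ^ 2 * √r) * (h ^ 2 * d) := by ring
        _ ≤ _ := mul_le_mul_of_nonneg_right h3 (by positivity)
    calc (q * h) ^ 2 * ρ ^ 2 * d ^ 2 = (q * h * ρ * d) ^ 2 := by ring
      _ ≤ (β / 10000 * (h ^ 2 * d)) ^ 2 := pow_le_pow_left₀ (by positivity) h1 2
      _ = _ := by ring
  · calc (q * h) ^ 2 * ρ * √r * h * d ^ 2
        ≤ (q * h) ^ 2 * (δ * (√r * (q * h))) * √r * h * d ^ 2 := by gcongr
      _ = δ * (q ^ 3 * √r ^ 2) * (h ^ 2 * d) ^ 2 := by ring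
      _ ≤ β / 10000 * (h ^ 2 * d) ^ 2 := by
        rw [hsr2]
        exact mul_le_mul_of_nonneg_right hδ (by positivity)

end ParameterRegime

/-! ### Local strong convexity and smoothness -/

theorem lemma1 (κ₀ : ℝ) :
    ∃ c₀ > (0 : ℝ), ∃ c₁ > (0 : ℝ), ∃ c₂ > (0 : ℝ), ∃ C > (0 : ℝ),
      ∀ (d r : ℕ) (Ustar : Matrix (Fin d) (Fin r) ℝ) (p δ : ℝ)
        (Ω : Type*) [MeasurableSpace Ω] (P : Measure Ω) [IsProbabilityMeasure P]
        (S : Ω → Set (Fin d × Fin d × Fin d)),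
        0 < d → 0 < r → (∀ i, Ustar.col i ≠ 0) → condNumber Ustar ≤ κ₀ →
        0 < p → IsSymmetricSampling P p S →
        c₀ * max (Real.log d ^ 3 / (d : ℝ) ^ (3 / 2 : ℝ))
          (incoherence Ustar ^ 2 * (r : ℝ) ^ 2 * Real.log d / (d : ℝ) ^ 2) ≤ p →
        (r : ℝ) ≤ c₁ * √(d / incoherence Ustar) →
        δ ≤ c₂ / (incoherence Ustar ^ (3 / 2 : ℝ) * r) →
        1 - C / (d : ℝ) ^ 10 ≤
          P.real {ω | ∀ U V : Matrix (Fin d) (Fin r) ℝ,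
            ‖U - Ustar‖ ≤ δ * ‖Ustar‖ →
            twoInftyNorm (U - Ustar) ≤ δ * twoInftyNorm Ustar →
            1 / 2 * lambdaMin Ustar ^ (4 / 3 : ℝ) * ‖V‖ ^ 2
                ≤ hessianForm (fClean p (S ω) Ustar) U V ∧
              hessianForm (fClean p (S ω) Ustar) U V
                ≤ 4 * lambdaMax Ustar ^ (4 / 3 : ℝ) * ‖V‖ ^ 2} := by
  classical
  -- all constants are multiples of a power of `β = max(κ₀, 1)⁻⁴`, for which `β σ⁴ ≤ m⁴`
  obtain ⟨β, hβ0, hβ1, hβκ⟩ : ∃ β : ℝ, 0 < β ∧ β ≤ 1 ∧ β * (max κ₀ 1) ^ 4 = 1 := by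
    have hK1 : 1 ≤ max κ₀ 1 := le_max_right _ _
    have hK0 : 0 < max κ₀ 1 := by linarith
    exact ⟨((max κ₀ 1) ^ 4)⁻¹, by positivity, inv_le_one_of_one_le₀ (one_le_pow₀ hK1),
      inv_mul_cancel₀ (by positivity)⟩
  refine ⟨1000000 / β, by positivity, β / 100, by positivity, β / 10000, by positivity, 3,
    by norm_num, ?_⟩
  intro d r u p δ Ω _ P _ S hd hr hu hcond hp hS hpd hrd hδ
  obtain ⟨m, σ, hm0, hσ0, hm, hσ, hκ, hmin, hmax⟩ := exists_extreme_euclNorm hr hu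
  have hμ1 := one_le_incoherence hr hu
  have hμentry := mul_entry_sq_le hu
  have hμcoh := fun i i' (hii : i ≠ i') => mul_dotProduct_sq_le hu hii
  have hd0 : (0 : ℝ) < d := by exact_mod_cast hd
  have hd1 : (1 : ℝ) ≤ d := by exact_mod_cast hd
  have hr1 : (1 : ℝ) ≤ r := by exact_mod_cast hr
  have hlog : 0 ≤ Real.log d := Real.log_nonneg hd1
  have hβσ : β * σ ^ 4 ≤ m ^ 4 := by
    rw [hκ, div_le_iff₀ hm0] at hcond
    have h1 : σ ≤ max κ₀ 1 * m := hcond.trans (mul_le_mul_of_nonneg_right (le_max_left _ _) hm0.le)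
    calc β * σ ^ 4 ≤ β * (max κ₀ 1 * m) ^ 4 :=
          mul_le_mul_of_nonneg_left (pow_le_pow_left₀ hσ0.le h1 4) hβ0.le
      _ = β * (max κ₀ 1) ^ 4 * m ^ 4 := by ring
      _ = m ^ 4 := by rw [hβκ, one_mul]
  -- `μ = q²`, entries of `u` are at most `B = q h`, and columns have norm at most `σ = h √d`
  generalize incoherence u = μ at *
  obtain ⟨q, hq1, hq2⟩ : ∃ q : ℝ, 1 ≤ q ∧ μ = q ^ 2 :=
    ⟨√μ, Real.one_le_sqrt.2 hμ1, (Real.sq_sqrt (by linarith)).symm⟩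
  have hq0 : 0 < q := by linarith
  have hsd : 0 < √(d : ℝ) := Real.sqrt_pos.2 hd0
  have hsd2 : √(d : ℝ) ^ 2 = d := Real.sq_sqrt hd0.le
  set h := σ / √(d : ℝ) with hh
  have hh0 : 0 < h := by positivity
  have hhd : h ^ 2 * d = σ ^ 2 := by
    rw [hh, div_pow, hsd2]; field_simp
  set B := q * h with hB
  have hB0 : 0 < B := by positivity
  have hhB : h ≤ B := le_mul_of_one_le_left hh0.le hq1
  have hs2 : ∀ i, euclNorm (u.col i) ^ 2 ≤ σ ^ 2 := fun i =>
    pow_le_pow_left₀ (euclNorm_nonneg _) (hσ i) 2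
  have hentry : ∀ j i, |u j i| ≤ B := by
    intro j i
    refine abs_le_of_sq_le_sq ?_ hB0.le
    have h1 := (hμentry j i).trans
      (mul_le_mul_of_nonneg_left (hs2 i) (by linarith : 0 ≤ μ))
    rw [← hhd, hq2] at h1
    refine le_of_mul_le_mul_left (h1.trans (le_of_eq ?_)) hd0
    rw [hB]; ring
  have hcolsq : ∀ i, ∑ j, u j i ^ 2 ≤ σ ^ 2 := fun i => by
    have := hs2 i
    rwa [euclNorm_sq] at this
  have hcolm : ∀ i, m ^ 2 ≤ ∑ j, u j i ^ 2 := fun i => by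
    have := pow_le_pow_left₀ hm0.le (hm i) 2
    rwa [euclNorm_sq] at this
  set g := q / √(d : ℝ) with hg
  have hg0 : 0 ≤ g := by positivity
  have hgd : (d : ℝ) * g ^ 2 = μ := by
    rw [hg, div_pow, hsd2, hq2]; field_simp
  have hsqrt : √((d : ℝ) / μ) = √(d : ℝ) / q := by
    rw [hq2, Real.sqrt_div hd0.le, Real.sqrt_sq hq0.le]
  have hgr : g * r ≤ β / 100 := by
    rw [hsqrt] at hrd
    have := mul_le_mul_of_nonneg_left hrd hg0
    refine this.trans (le_of_eq ?_)
    rw [hg]; field_simp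
  have hg1 : g ≤ 1 := by
    have : g ≤ g * r := le_mul_of_one_le_right hg0 hr1
    linarith
  have hcoh : ∀ i i', i ≠ i' → |∑ j, u j i * u j i'| ≤ g * σ ^ 2 := by
    intro i i' hii
    refine abs_le_of_sq_le_sq ?_ (by positivity)
    have h1 := (hμcoh i i' hii).trans (mul_le_mul_of_nonneg_left
      (mul_le_mul (hs2 i) (hs2 i') (sq_nonneg _) (sq_nonneg _)) (by linarith : 0 ≤ μ))
    refine le_of_mul_le_mul_left (h1.trans (le_of_eq ?_)) hd0
    rw [← hgd]; ring
  have hrd' : r ≤ d := by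
    have h1 : (r : ℝ) ≤ √(d : ℝ) := by
      rw [hsqrt] at hrd
      have h2 : √(d : ℝ) / q ≤ √(d : ℝ) := div_le_self hsd.le hq1
      have h3 : β / 100 * (√(d : ℝ) / q) ≤ 1 * (√(d : ℝ) / q) :=
        mul_le_mul_of_nonneg_right (by linarith) (by positivity)
      linarith
    have h2 : √(d : ℝ) ≤ d := Real.sqrt_le_left (by linarith) |>.2 (by nlinarith)
    exact_mod_cast h1.trans h2
  -- the lower bound on `p`, cleared of denominators
  have hpL : 1000000 * (q ^ 4 * (r : ℝ) ^ 2 * Real.log d) ≤ β * (p * (d : ℝ) ^ 2) := by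
    have h1 := (mul_le_mul_of_nonneg_left (le_max_right (Real.log d ^ 3 / (d : ℝ) ^ (3 / 2 : ℝ))
      (μ ^ 2 * (r : ℝ) ^ 2 * Real.log d / (d : ℝ) ^ 2))
      (by positivity : 0 ≤ 1000000 / β)).trans hpd
    rw [div_mul_div_comm, div_le_iff₀ (by positivity), hq2] at h1
    linarith [h1, (by ring : (1000000 : ℝ) * ((q ^ 2) ^ 2 * (r : ℝ) ^ 2 * Real.log d)
      = 1000000 * (q ^ 4 * (r : ℝ) ^ 2 * Real.log d))]
  obtain ⟨hrate₁, hrate₂⟩ := sampling_rate_bounds hq1 hh0 hβ1 hp hlog hr1 hpL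
  have hσ4 : (h ^ 2 * d) ^ 2 = σ ^ 4 := by rw [hhd]; ring
  rw [hσ4] at hrate₂
  refine hS.one_sub_le_measureReal hp.le hd hr hrd' (u := u) (h := h) (B := B)
    (ν := β / 100 * σ ^ 4) hh0 hhB hentry (fun i => (hcolsq i).trans hhd.ge) hrate₁ hrate₂ ?_
  intro ω hdeg hquad U V hUF hU2
  rw [frobenius_norm_sq, hmin, hmax]
  have hδ0 : 0 ≤ δ := by
    by_contra! hneg
    have hne : u ≠ 0 := by
      rintro rfl
      exact hu ⟨0, hr⟩ (by ext j; simp)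
    have := mul_neg_of_neg_of_pos hneg (norm_pos_iff.2 hne)
    linarith [norm_nonneg (U - u)]
  have hδq : δ * (q ^ 3 * r) ≤ β / 10000 := by
    have h1 : μ ^ (3 / 2 : ℝ) = q ^ 3 := by
      rw [hq2, ← Real.rpow_natCast, ← Real.rpow_natCast, ← Real.rpow_mul hq0.le]
      norm_num
    rwa [h1, le_div_iff₀ (by positivity)] at hδ
  set ρ := δ * twoInftyNorm u with hρ
  have hρ0 : 0 ≤ ρ := mul_nonneg hδ0 (Real.iSup_nonneg fun i => euclNorm_nonneg _)
  obtain ⟨hρh, hsmall₁, hsmall₂⟩ := radius_bounds hq1 hh0 hβ1 hr1 hd0 hδ0 hδq hρ0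
    (mul_le_mul_of_nonneg_left (twoInftyNorm_le hd hB0.le hentry) hδ0)
  rw [hσ4] at hsmall₁ hsmall₂
  have hUrow : ∀ j, ∑ i, (U j i - u j i) ^ 2 ≤ ρ ^ 2 := fun j => by
    have h1 := sum_row_sq_le_twoInftyNorm_sq (U - u) j
    have h2 := pow_le_pow_left₀ (Real.iSup_nonneg fun i => euclNorm_nonneg _) hU2 2
    exact h1.trans h2
  refine hessianForm_bounds hr hp (hS.swap_left_iff ω) (hS.swap_right_iff ω) hβ0 hβ1 hβσ hg0 hg1
    hgr hcolsq hcolm hcoh hentry hρ0 (hρh.trans hhB) hρh hh0 hUrow hsmall₁ hsmall₂ hdeg ?_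
  simpa only [mul_assoc] using hquad V
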